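/- Let $1\le m\le n$ be integers and let $X\subset\mathbb C^n$ be compact. Definitions. Put $\beta=dd^c|z|^2$ and let $\Gamma_m$ be the set of real $(1,1)$-forms $\eta$ on $\mathbb C^n$ with constant coefficients such that $\eta^k\wedge\beta^{n-k}\ge 0$ for $k=1,\dots,m$. A continuous real-valued function $u$ on an open set $U\subset\mathbb C^n$ is $m$-subharmonic if it is subharmonic and $dd^cu\wedge\eta_1\wedge\dots\wedge\eta_{m-1}\wedge\beta^{n-m}\ge 0$ in the sense of currents on $U$ for all $\eta_1,\dots,\eta_{m-1}\in\Gamma_m$. Let $\mathcal{SH}_m^o(X)$ be the set of restrictions to $X$ of functions that are continuous and $m$-subharmonic on some open neighbourhood of $X$ (which may depend on the function). For $z\in X$ let $\mathcal J_z^m(X)$ be the set of regular Borel probability measures $\mu$ on $X$ with $u(z)\le\int_X u\,d\mu$ for all $u\in\mathcal{SH}_m^o(X)$. Let $\mathcal{USC}(X)$ be the set of upper semicontinuous functions $X\to[-\infty,\infty)$, and $\mathcal C(X)$ the set of continuous functions $X\to\mathbb R$. Let $\mathcal{SH}_m(X)$ be the set of $u\in\mathcal{USC}(X)$ (the constant $-\infty$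 is allowed) such that $u(z)\le\int_X u\,d\mu$ for all $z\in X$ and all $\mu\in\mathcal J_z^m(X)$. Theorem. (a) Let $u\in\mathcal{USC}(X)$. Then $u\in\mathcal{SH}_m(X)\cap\mathcal C(X)$ if and only if there is a sequence $u_j\in\mathcal{SH}_m^o(X)$ that increases pointwise on $X$ to $u$. (b) Let $u:X\to[-\infty,\infty]$. Then $u\in\mathcal{SH}_m(X)$ if and only if there is a sequence $u_j\in\mathcal{SH}_m^o(X)$ that decreases pointwise on $X$ to $u$. (Increasing and decreasing are meant in the weak sense.) -/

import Mathlib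

open scoped ContDiff

noncomputable section

namespace MSubh

open MeasureTheory Filter Topology

/-- The space `ℂⁿ`, with its Euclidean norm and Lebesgue measure. -/
abbrev Cn (n : ℕ) : Type := EuclideanSpace ℂ (Fin n)

/-- The mixed discriminant of `n` complex `n × n` matrices. If `η_k` is the `(1,1)`-form
`∑ (A k) i j • (√-1 dz_i ∧ dz̄_j)`, then `η_1 ∧ ⋯ ∧ η_n` is `n!` times this number
times the volume form `∏_j (√-1 dz_j ∧ dz̄_j)`. -/
def mixedDisc {n : ℕ} (A : Fin n → Matrix (Fin n) (Fin n) ℂ) : ℂ :=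
  ((n.factorial : ℂ))⁻¹ *
    ∑ σ : Equiv.Perm (Fin n), (Matrix.of fun i j => A (σ j) i j).det

/-- The cone `Γ_m` of real `(1,1)`-forms `η` with constant coefficients (that is, of Hermitian
matrices `H`) such that `η ^ k ∧ β ^ (n - k) ≥ 0` for `k = 1, …, m`, where `β = dd^c |z|²`
corresponds (up to a positive factor) to the identity matrix. -/
def gardingCone (n m : ℕ) : Set (Matrix (Fin n) (Fin n) ℂ) :=
  {H | H.IsHermitian ∧ ∀ k : ℕ, 1 ≤ k → k ≤ m →
    0 ≤ (mixedDisc (fun i : Fin n => if (i : ℕ) < k then H else 1)).re}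

/-- The second real directional derivative `∂_v ∂_w φ (z)`. -/
def secondDeriv {n : ℕ} (φ : Cn n → ℝ) (z v w : Cn n) : ℝ :=
  fderiv ℝ (fderiv ℝ φ) z v w

/-- The complex Hessian `(∂²φ / ∂z_j ∂z̄_k)_{j,k}`, where `∂/∂z_j = (∂/∂x_j - i ∂/∂y_j) / 2`
and `∂/∂z̄_k = (∂/∂x_k + i ∂/∂y_k) / 2`. -/
def complexHessian {n : ℕ} (φ : Cn n → ℝ) (z : Cn n) : Matrix (Fin n) (Fin n) ℂ :=
  Matrix.of fun j k =>
    let ex : Fin n → Cn n := fun l => EuclideanSpace.single l (1 : ℂ)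
    let ey : Fin n → Cn n := fun l => EuclideanSpace.single l Complex.I
    (1 / 4 : ℂ) *
      (((secondDeriv φ z (ex j) (ex k) + secondDeriv φ z (ey j) (ey k) : ℝ) : ℂ) +
        Complex.I *
          ((secondDeriv φ z (ex j) (ey k) - secondDeriv φ z (ey j) (ex k) : ℝ) : ℂ))

/-- The density of `dd^c φ ∧ η_1 ∧ ⋯ ∧ η_{m-1} ∧ β ^ (n - m)` with respect to Lebesgue measure,
up to a positive constant that depends only on `n`; here `η_k` is the form with
matrix `H k`, and only `H 1, …, H (m - 1)` are used. -/
def hessianDensity {n : ℕ} (m : ℕ) (H : ℕ → Matrix (Fin n) (Fin n) ℂ)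
    (φ : Cn n → ℝ) (z : Cn n) : ℝ :=
  (mixedDisc (fun i : Fin n =>
    if (i : ℕ) = 0 then complexHessian φ z else if (i : ℕ) < m then H i else 1)).re

/-- Subharmonicity of a real-valued (finite) function on an open set `U`: upper semicontinuity
and the submean value property over all closed balls in `U`. -/
structure IsSubharmonicOn {n : ℕ} (u : Cn n → ℝ) (U : Set (Cn n)) : Prop where
  usc : UpperSemicontinuousOn u U
  locInt : LocallyIntegrableOn u U volume
  submean : ∀ (a : Cn n) (r : ℝ), 0 < r → Metric.closedBall a r ⊆ U →
    u a ≤ ⨍ z in Metric.closedBall a r, u z ∂volume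

/-- A real-valued (finite) function `u` is `m`-subharmonic on the open set `U` if it is
subharmonic and `dd^c u ∧ η_1 ∧ ⋯ ∧ η_{m-1} ∧ β ^ (n - m) ≥ 0` in the sense of currents for all
`η_1, …, η_{m-1}` in the cone `Γ_m`, i.e. the left side is non-negative when paired with
each non-negative test function. -/
structure IsMSubharmonicOn {n : ℕ} (m : ℕ) (u : Cn n → ℝ) (U : Set (Cn n)) : Prop where
  subharmonic : IsSubharmonicOn u U
  current_nonneg : ∀ H : ℕ → Matrix (Fin n) (Fin n) ℂ, (∀ k, H k ∈ gardingCone n m) →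
    ∀ φ : Cn n → ℝ, ContDiff ℝ ∞ φ → HasCompactSupport φ → tsupport φ ⊆ U → (∀ z, 0 ≤ φ z) →
      0 ≤ ∫ z, u z * hessianDensity m H φ z ∂volume

/-- `SH_m^o(X)`: restrictions to `X` of functions that are continuous and `m`-subharmonic on some
open neighbourhood of `X`. -/
def SHo {n : ℕ} (m : ℕ) (X : Set (Cn n)) : Set (X → ℝ) :=
  {f | ∃ (U : Set (Cn n)) (v : Cn n → ℝ), IsOpen U ∧ X ⊆ U ∧ ContinuousOn v U ∧
    IsMSubharmonicOn m v U ∧ ∀ x : X, f x = v x}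

/-- `J_z^m(X)`: regular Borel probability measures on `X` that are Jensen measures with
barycenter `z` with respect to `SH_m^o(X)`. -/
def jensenMeasures {n : ℕ} (m : ℕ) (X : Set (Cn n)) (z : X) : Set (Measure X) :=
  {μ | IsProbabilityMeasure μ ∧ μ.Regular ∧ ∀ f ∈ SHo m X, f z ≤ ∫ x, f x ∂μ}

/-- The integral `∫ u⁺ - ∫ u⁻` of an extended-real function. It is used only for upper
semicontinuous functions without the value `+∞` on a compact space and finite measures, where
`∫ u⁺` is finite; the value `-∞` is possible. -/
def extIntegral {α : Type*} [MeasurableSpace α] (u : α → EReal) (μ : Measure α) : EReal :=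
  ((∫⁻ x, (u x).toENNReal ∂μ : ENNReal) : EReal) - ((∫⁻ x, (-u x).toENNReal ∂μ : ENNReal) : EReal)

/-- `USC(X)`: upper semicontinuous functions on `X` with values in `[-∞, ∞)`. -/
def USC {n : ℕ} (X : Set (Cn n)) : Set (X → EReal) :=
  {u | UpperSemicontinuous u ∧ ∀ x, u x ≠ ⊤}

/-- `SH_m(X)`: the `m`-subharmonic functions on the compact set `X`. -/
def SH {n : ℕ} (m : ℕ) (X : Set (Cn n)) : Set (X → EReal) :=
  {u | u ∈ USC X ∧ ∀ z : X, ∀ μ ∈ jensenMeasures m X z, u z ≤ extIntegral u μ}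

/-- `C(X)`: the continuous real-valued functions on `X`, as extended-real functions. -/
def CX {n : ℕ} (X : Set (Cn n)) : Set (X → EReal) :=
  {u | ∃ g : X → ℝ, Continuous g ∧ ∀ x, u x = (g x : EReal)}

/-- `f_j ↗ u`: the sequence is pointwise increasing with pointwise limit `u`. -/
def IncreasesTo {α : Type*} (f : ℕ → α → ℝ) (u : α → EReal) : Prop :=
  ∀ x, Monotone (fun j => f j x) ∧ Tendsto (fun j => (f j x : EReal)) atTop (𝓝 (u x))

/-- `f_j ↘ u`: the sequence is pointwise decreasing with pointwise limit `u`. -/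
def DecreasesTo {α : Type*} (f : ℕ → α → ℝ) (u : α → EReal) : Prop :=
  ∀ x, Antitone (fun j => f j x) ∧ Tendsto (fun j => (f j x : EReal)) atTop (𝓝 (u x))

end MSubh

end

open scoped ContDiff

noncomputable section

namespace MSubh

open MeasureTheory Filter Topology


/-! The theorem is Edwards' duality applied to `SHo m X`, once this set is known to be a convex cone
of continuous functions that contains the constants and is stable under maxima.

Duality: let `φ` be continuous on the compact set `X`. If all minorants of `φ` in `SHo` are at most
`a` at `z`, Hahn–Banach and Riesz produce a Jensen measure for `z` with `∫ φ ≤ a`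
(`exists_jensenMeasure_integral_le`). For `u` in `SH` with `u < φ`, semicontinuity gives a uniform
gap `ε`, so every Jensen measure for `z` has `∫ φ ≥ u z + ε`. Hence some minorant of `φ` in `SHo`
exceeds `u` at `z`. Compactness and maxima then give one `v` in `SHo` with `u < v ≤ φ`
(`exists_mem_SHo_between`). Iterating this sandwich yields both monotone sequences; the converses
are passages to the limit under the integral.

The hard point is stability under maxima. For fixed forms `H`, the current condition is a weak
inequality for a constant-coefficient second order operator. Gårding's inequality makes the
coefficient matrix of this operator positive semidefinite, so the operator is a sum of squares of
directional derivatives (`exists_hessianDensity_eq_sqLap`). Such inequalities can be read off second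
differences after mollification, and second differences visibly respect maxima (`SecDiffNonneg.sup`,
`WeakNonneg.sup`).

Gårding's inequality (`garding_inequality`) comes from hyperbolicity. The determinant has no zero on
the tube over the positive definite matrices; by Gauss–Lucas this property survives directional
differentiation, which replaces one slot of the mixed discriminant by a fixed matrix. Following
roots along segments enlarges the cone to the whole hyperbolicity cone and shows that it is convex.
That cone contains every `H + ε • 1` with `H` in `Γ_m` and `ε > 0`, and mixed discriminants are
positive on it. -/

/-! ### The mixed discriminant as a symmetric multilinear map -/

/-- Complex `n × n` matrices. -/
abbrev Mat (n : ℕ) : Type := Matrix (Fin n) (Fin n) ℂ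

/-- The `j`-th column of a matrix, as a linear map. -/
def colLin {n : ℕ} (j : Fin n) : Mat n →ₗ[ℂ] (Fin n → ℂ) where
  toFun A := fun i => A i j
  map_add' _ _ := rfl
  map_smul' _ _ := rfl

/-- The mixed discriminant as a multilinear map. -/
def mixedDiscMulti (n : ℕ) : MultilinearMap ℂ (fun _ : Fin n => Mat n) ℂ :=
  ((n.factorial : ℂ))⁻¹ • ∑ σ : Equiv.Perm (Fin n), MultilinearMap.domDomCongr σ
    ((Matrix.detRowAlternating (n := Fin n) (R := ℂ)).toMultilinearMap.compLinearMap colLin)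

theorem mixedDiscMulti_apply {n : ℕ} (A : Fin n → Mat n) : mixedDiscMulti n A = mixedDisc A := by
  simp only [mixedDiscMulti, mixedDisc, smul_apply, sum_apply,
    smul_eq_mul]
  congr 1
  refine Finset.sum_congr rfl fun σ _ => ?_
  rw [← Matrix.det_transpose]
  rfl

theorem mixedDisc_comp_perm {n : ℕ} (A : Fin n → Mat n) (τ : Equiv.Perm (Fin n)) :
    mixedDisc (fun i => A (τ i)) = mixedDisc A := by
  unfold mixedDisc
  congr 1
  exact Fintype.sum_equiv (Equiv.mulLeft τ) _ _ fun σ => rfl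

theorem mixedDisc_const {n : ℕ} (Z : Mat n) : mixedDisc (fun _ => Z) = Z.det := by
  unfold mixedDisc
  have h : ∀ σ : Equiv.Perm (Fin n), (Matrix.of fun i j => Z i j).det = Z.det := fun σ => rfl
  rw [Finset.sum_congr rfl fun σ _ => h σ, Finset.sum_const, Finset.card_univ, Fintype.card_perm,
    Fintype.card_fin, nsmul_eq_mul, inv_mul_cancel_left₀]
  exact_mod_cast n.factorial_ne_zero

theorem continuous_mixedDisc {n : ℕ} : Continuous fun A : Fin n → Mat n => mixedDisc A := by
  unfold mixedDisc
  refine continuous_const.mul (continuous_finsetSum _ fun σ _ => Continuous.matrix_det ?_)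
  refine continuous_pi fun i => continuous_pi fun j => ?_
  have h : Continuous fun A : Fin n → Mat n => A (σ j) := continuous_apply (σ j)
  exact h.matrix_elem i j

/-- Conjugation exchanges rows and columns; in the double sum over slot assignments `σ` and
determinant permutations `τ` this is undone by `τ ↦ τ⁻¹`, `σ ↦ σ * τ⁻¹`. -/
theorem mixedDisc_conj {n : ℕ} (A : Fin n → Mat n) (hA : ∀ i, (A i).IsHermitian) :
    (starRingEnd ℂ) (mixedDisc A) = mixedDisc A := by
  have key : ∀ B : Fin n → Mat n, ∑ σ : Equiv.Perm (Fin n),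
      (Matrix.of fun i j => B (σ j) i j).det =
      ∑ τ : Equiv.Perm (Fin n), ∑ σ : Equiv.Perm (Fin n),
        ((Equiv.Perm.sign τ : ℤ) : ℂ) * ∏ j, B (σ j) (τ j) j := by
    intro B
    rw [Finset.sum_comm]
    refine Finset.sum_congr rfl fun σ _ => ?_
    rw [Matrix.det_apply']
    rfl
  unfold mixedDisc
  rw [key]
  simp only [map_mul, map_inv₀, map_natCast, map_sum, map_prod, map_intCast]
  congr 1
  refine Fintype.sum_equiv (Equiv.inv _) _ _ fun τ => ?_
  refine Fintype.sum_equiv (Equiv.mulRight τ⁻¹) _ _ fun σ => ?_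
  simp only [Equiv.inv_apply, Equiv.Perm.sign_inv, Equiv.coe_mulRight, Equiv.Perm.mul_apply]
  congr 1
  refine Fintype.prod_equiv τ _ _ fun j => ?_
  rw [show τ⁻¹ (τ j) = j from τ.symm_apply_apply j]
  have := congrFun (congrFun (hA (σ j)) j) (τ j)
  rw [Matrix.conjTranspose_apply] at this
  exact this

theorem mixedDisc_im {n : ℕ} (A : Fin n → Mat n) (hA : ∀ i, (A i).IsHermitian) :
    (mixedDisc A).im = 0 :=
  Complex.conj_eq_iff_im.1 (mixedDisc_conj A hA)

/-! ### Slots -/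

/-- The tuple with `Z` in the first `k` slots and the entries of `b` in the others. -/
def slots {n : ℕ} (k : ℕ) (b : Fin n → Mat n) (Z : Mat n) : Fin n → Mat n :=
  fun i => if (i : ℕ) < k then Z else b i

/-- The homogeneous polynomial of degree `k` on matrices given by a mixed discriminant. -/
def mpoly {n : ℕ} (k : ℕ) (b : Fin n → Mat n) (Z : Mat n) : ℂ := mixedDisc (slots k b Z)

theorem card_filter_val_lt {n k : ℕ} (hk : k ≤ n) :
    (Finset.univ.filter fun i : Fin n => (i : ℕ) < k).card = k := by
  rw [Fin.card_filter_val_lt, min_eq_right hk]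

theorem mpoly_smul {n k : ℕ} (hk : k ≤ n) (b : Fin n → Mat n) (c : ℂ) (Z : Mat n) :
    mpoly k b (c • Z) = c ^ k * mpoly k b Z := by
  have h : slots k b (c • Z) = fun i : Fin n => (if (i : ℕ) < k then c else 1) • slots k b Z i := by
    funext i
    unfold slots
    split_ifs <;> simp
  rw [mpoly, h, ← mixedDiscMulti_apply, MultilinearMap.map_smul_univ, mixedDiscMulti_apply,
    Finset.prod_ite, Finset.prod_const, Finset.prod_const_one, mul_one, card_filter_val_lt hk]
  rfl

theorem continuous_mpoly {n k : ℕ} (b : Fin n → Mat n) : Continuous (mpoly k b) := by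
  refine continuous_mixedDisc.comp (continuous_pi fun i => ?_)
  unfold slots
  split_ifs
  · exact continuous_id
  · exact continuous_const

open Polynomial in
/-- Restriction of `mpoly` to a complex line. -/
def linePoly {n : ℕ} (k : ℕ) (b : Fin n → Mat n) (Z W : Mat n) : ℂ[X] :=
  ∑ s : Finset (Fin n), C (mixedDisc (s.piecewise (slots k (fun _ => 0) W) (slots k b Z))) *
    X ^ s.card

theorem eval_linePoly {n k : ℕ} (b : Fin n → Mat n) (Z W : Mat n) (t : ℂ) :
    (linePoly k b Z W).eval t = mpoly k b (Z + t • W) := by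
  -- The tuple of `W` carries `0` beyond slot `k`, so the slots filled by `b` are unaffected and `t`
  -- counts only active slots.
  have h : slots k b (Z + t • W) =
      (fun i => t • slots k (fun _ => 0) W i) + slots k b Z := by
    funext i
    simp only [slots, Pi.add_apply]
    split_ifs
    · rw [add_comm]
    · simp
  rw [mpoly, h, ← mixedDiscMulti_apply, MultilinearMap.map_add_univ, linePoly,
    Polynomial.eval_finsetSum]
  refine Finset.sum_congr rfl fun s _ => ?_
  have := (mixedDiscMulti n).map_piecewise_smul (fun _ => t)
    (s.piecewise (slots k (fun _ => 0) W) (slots k b Z)) s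
  rw [Finset.prod_const, smul_eq_mul, mixedDiscMulti_apply (s.piecewise (slots _ _ _) _)] at this
  simp only [Polynomial.eval_mul, Polynomial.eval_C, Polynomial.eval_pow, Polynomial.eval_X]
  rw [mul_comm, ← this]
  congr 1
  funext i
  by_cases hi : i ∈ s <;> simp [hi]

theorem piecewise_slots_eq_zero {n k : ℕ} (b : Fin n → Mat n) (Z W : Mat n) {s : Finset (Fin n)}
    {i : Fin n} (hi : i ∈ s) (hik : ¬ (i : ℕ) < k) :
    mixedDisc (s.piecewise (slots k (fun _ => 0) W) (slots k b Z)) = 0 := by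
  rw [← mixedDiscMulti_apply]
  refine MultilinearMap.map_coord_zero _ i ?_
  simp [hi, slots, hik]

theorem natDegree_linePoly_le {n k : ℕ} (hk : k ≤ n) (b : Fin n → Mat n) (Z W : Mat n) :
    (linePoly k b Z W).natDegree ≤ k := by
  refine Polynomial.natDegree_sum_le_of_forall_le _ _ fun s _ => ?_
  by_cases h : ∃ i ∈ s, ¬ (i : ℕ) < k
  · obtain ⟨i, hi, hik⟩ := h
    rw [piecewise_slots_eq_zero b Z W hi hik]
    simp
  · push Not at h
    refine (Polynomial.natDegree_C_mul_X_pow_le _ _).trans ?_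
    rw [← card_filter_val_lt hk]
    exact Finset.card_le_card fun i hi => by simpa using h i hi

theorem coeff_linePoly {n k : ℕ} (b : Fin n → Mat n) (Z W : Mat n) (d : ℕ) :
    (linePoly k b Z W).coeff d = ∑ s ∈ Finset.univ.filter fun s : Finset (Fin n) => s.card = d,
      mixedDisc (s.piecewise (slots k (fun _ => 0) W) (slots k b Z)) := by
  rw [linePoly, Polynomial.finsetSum_coeff, Finset.sum_filter]
  refine Finset.sum_congr rfl fun s _ => ?_
  rw [Polynomial.coeff_C_mul, Polynomial.coeff_X_pow]
  by_cases h : s.card = d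
  · simp [h]
  · simp [h, Ne.symm h]

theorem coeff_linePoly_top {n k : ℕ} (hk : k ≤ n) (b : Fin n → Mat n) (Z W : Mat n) :
    (linePoly k b Z W).coeff k = mpoly k b W := by
  rw [coeff_linePoly, Finset.sum_eq_single (Finset.univ.filter fun i : Fin n => (i : ℕ) < k)]
  · unfold mpoly
    congr 1
    funext i
    by_cases hi : (i : ℕ) < k <;> simp [hi, slots, Finset.piecewise]
  · intro s hs hne
    by_cases h : ∃ i ∈ s, ¬ (i : ℕ) < k
    · obtain ⟨i, hi, hik⟩ := h
      exact piecewise_slots_eq_zero b Z W hi hik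
    · push Not at h
      refine absurd (Finset.eq_of_subset_of_card_le (fun i hi => by simpa using h i hi) ?_) hne
      rw [card_filter_val_lt hk, (Finset.mem_filter.1 hs).2]
  · intro h
    exact absurd (by simp only [Finset.mem_filter, Finset.mem_univ, true_and]; exact card_filter_val_lt hk) h

/-- By symmetry each of the `k + 1` active slots contributes equally. Thus `mpoly k b` is, up to a
factor, the derivative of `mpoly (k + 1) b` in the direction `b k`, which is what Gauss–Lucas needs.
-/
theorem coeff_linePoly_one {n k : ℕ} (hk : k < n) (b : Fin n → Mat n) (Z : Mat n) :
    (linePoly (k + 1) b Z (b ⟨k, hk⟩)).coeff 1 = (k + 1) * mpoly k b Z := by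
  set W := b ⟨k, hk⟩ with hW
  have h1 : (Finset.univ.filter fun s : Finset (Fin n) => s.card = 1) =
      Finset.univ.map ⟨singleton, Finset.singleton_injective⟩ := by
    rw [← Finset.powersetCard_one]
    ext s
    simp [Finset.mem_powersetCard]
  rw [coeff_linePoly, h1, Finset.sum_map]
  have h2 : ∀ i : Fin n, mixedDisc ((({i} : Finset (Fin n))).piecewise
      (slots (k + 1) (fun _ => 0) W) (slots (k + 1) b Z)) =
      if (i : ℕ) < k + 1 then mpoly k b Z else 0 := by
    intro i
    split_ifs with hi
    · rw [mpoly, ← mixedDisc_comp_perm (slots k b Z) (Equiv.swap i ⟨k, hk⟩)]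
      congr 1
      funext j
      by_cases hji : j = i
      · subst hji
        simp [slots, hi, hW]
      · by_cases hjk : j = ⟨k, hk⟩
        · subst hjk
          have : (i : ℕ) < k := lt_of_le_of_ne (Nat.lt_succ_iff.1 hi)
            fun h => hji (Fin.ext h.symm)
          simp [slots, this, Finset.piecewise, hji]
        · rw [Equiv.swap_apply_of_ne_of_ne hji hjk]
          have : (j : ℕ) ≠ k := fun h => hjk (Fin.ext h)
          have e : (j : ℕ) < k + 1 ↔ (j : ℕ) < k := by omega
          simp [slots, Finset.piecewise, hji, e]
    · exact piecewise_slots_eq_zero b Z W (Finset.mem_singleton_self i) hi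
  simp only [Function.Embedding.coeFn_mk]
  rw [Finset.sum_congr rfl fun i _ => h2 i, ← Finset.sum_filter, Finset.sum_const,
    card_filter_val_lt hk, nsmul_eq_mul]
  push_cast
  ring


/-! ### Hyperbolicity and Gårding's inequality -/

/-- `mpoly k b` has no zeros on the tube over the cone `C` of Hermitian matrices. -/
def NonvanishingOnTube {n : ℕ} (k : ℕ) (b : Fin n → Mat n) (C : Set (Mat n)) : Prop :=
  ∀ x : Mat n, x.IsHermitian → ∀ y ∈ C, mpoly k b (x + Complex.I • y) ≠ 0

theorem isHermitian_real_smul {n : ℕ} {A : Mat n} (hA : A.IsHermitian) (t : ℝ) :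
    ((t : ℂ) • A).IsHermitian := by
  unfold Matrix.IsHermitian
  rw [Matrix.conjTranspose_smul, hA.eq]
  simp

/-- A cone of Hermitian matrices. -/
structure IsHermCone {n : ℕ} (C : Set (Mat n)) : Prop where
  herm : ∀ A ∈ C, A.IsHermitian
  add : ∀ A ∈ C, ∀ B ∈ C, A + B ∈ C
  smul : ∀ A ∈ C, ∀ t : ℝ, 0 < t → (t : ℂ) • A ∈ C

theorem NonvanishingOnTube.mpoly_ne_zero {n k : ℕ} (hk : k ≤ n) {b : Fin n → Mat n}
    {C : Set (Mat n)} (h : NonvanishingOnTube k b C) {y : Mat n} (hy : y ∈ C) :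
    mpoly k b y ≠ 0 := by
  intro h0
  refine h 0 Matrix.isHermitian_zero y hy ?_
  rw [zero_add, mpoly_smul hk, h0, mul_zero]

theorem NonvanishingOnTube.neg {n k : ℕ} (hk : k ≤ n) {b : Fin n → Mat n}
    {C : Set (Mat n)} (h : NonvanishingOnTube k b C) {x y : Mat n} (hx : x.IsHermitian)
    (hy : y ∈ C) : mpoly k b (x - Complex.I • y) ≠ 0 := by
  have h1 : x - Complex.I • y = (-1 : ℂ) • (-x + Complex.I • y) := by
    simp [sub_eq_add_neg]
  rw [h1, mpoly_smul hk]
  exact mul_ne_zero (pow_ne_zero _ (by norm_num)) (h _ hx.neg y hy)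

/-- Gauss–Lucas: on the line `x + i y + t W` with `W = b k`, a root with `Im t ≥ 0` would lie in the
tube. All roots are therefore in the open lower half-plane, hence so are those of the derivative,
and `t = 0` is not one of them. -/
theorem NonvanishingOnTube.derivative {n k : ℕ} (hk : k < n) {b : Fin n → Mat n}
    {C : Set (Mat n)} (hC : IsHermCone C) (h : NonvanishingOnTube (k + 1) b C)
    (hb : b ⟨k, hk⟩ ∈ C) : NonvanishingOnTube k b C := by
  intro x hx y hy h0
  set W := b ⟨k, hk⟩ with hW
  set Q := linePoly (k + 1) b (x + Complex.I • y) W with hQ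
  have hlead : Q.coeff (k + 1) ≠ 0 := by
    rw [hQ, coeff_linePoly_top hk]
    exact h.mpoly_ne_zero hk hb
  have hdeg : 0 < Q.degree := by
    rw [← Polynomial.natDegree_pos_iff_degree_pos]
    exact lt_of_lt_of_le (Nat.succ_pos k) (Polynomial.le_natDegree_of_ne_zero hlead)
  have hd0 : Q.derivative.eval 0 = 0 := by
    rw [← Polynomial.coeff_zero_eq_eval_zero, Polynomial.coeff_derivative, hQ, zero_add,
      coeff_linePoly_one hk, h0]
    simp
  have hne : Q.derivative ≠ 0 := by
    intro h'
    have := Polynomial.derivative_eq_zero.1 h'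
    rw [← Polynomial.natDegree_pos_iff_degree_pos] at hdeg
    omega
  have hmem : (0 : ℂ) ∈ Q.derivative.rootSet ℂ := by
    rw [Polynomial.mem_rootSet]
    exact ⟨hne, by simpa using hd0⟩
  have hroots : Q.rootSet ℂ ⊆ {c : ℂ | c.im < 0} := by
    intro t ht
    rw [Polynomial.mem_rootSet] at ht
    have ht2 : Q.eval t = 0 := by simpa using ht.2
    rw [hQ, eval_linePoly] at ht2
    by_contra him
    have him : 0 ≤ t.im := not_lt.1 him
    have e : x + Complex.I • y + t • W =
        (x + (t.re : ℂ) • W) + Complex.I • (y + (t.im : ℂ) • W) := by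
      conv_lhs => rw [← Complex.re_add_im t]
      rw [add_smul, smul_add, mul_comm, mul_smul]
      abel
    rw [e] at ht2
    refine h _ (hx.add (isHermitian_real_smul (hC.herm _ hb) _)) _ ?_ ht2
    rcases him.eq_or_lt with h' | h'
    · rw [← h']; simpa using hy
    · exact hC.add _ hy _ (hC.smul _ hb _ h')
  have := convexHull_min hroots (convex_halfSpace_im_lt 0)
    (Polynomial.rootSet_derivative_subset_convexHull_rootSet hdeg hmem)
  simp at this

theorem NonvanishingOnTube.iterate {n k : ℕ} (hk : k ≤ n) {b : Fin n → Mat n}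
    {C : Set (Mat n)} (hC : IsHermCone C) (h : NonvanishingOnTube k b C) {l : ℕ} (hl : l ≤ k)
    (hb : ∀ i : Fin n, l ≤ (i : ℕ) → (i : ℕ) < k → b i ∈ C) : NonvanishingOnTube l b C := by
  induction k, hl using Nat.le_induction with
  | base => exact h
  | succ k hlk ih =>
    exact ih (by omega) (h.derivative (by omega) hC (hb ⟨k, hk⟩ hlk (Nat.lt_succ_self k)))
      fun i h1 h2 => hb i h1 (by omega)

/-- Roots of `mpoly k b (A + t • W)` depend continuously on `A`. -/
theorem eventually_exists_root {n k : ℕ} (hk : k ≤ n) (b : Fin n → Mat n) {W A₀ : Mat n}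
    (hW : mpoly k b W ≠ 0) {t₀ : ℂ} (h0 : mpoly k b (A₀ + t₀ • W) = 0) {ε : ℝ} (hε : 0 < ε) :
    ∀ᶠ A in 𝓝 A₀, ∃ t ∈ Metric.ball t₀ ε, mpoly k b (A + t • W) = 0 := by
  have hc : Continuous fun A : Mat n => ‖mpoly k b (A + t₀ • W)‖ :=
    ((continuous_mpoly b).comp (continuous_id.add continuous_const)).norm
  -- The lower bound that factorization gives at `t₀` when all `k` roots stay at distance at least
  -- `ε`.
  have hpos : 0 < ‖mpoly k b W‖ * ε ^ k := by
    have := norm_pos_iff.2 hW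
    positivity
  have hev : ∀ᶠ A in 𝓝 A₀, ‖mpoly k b (A + t₀ • W)‖ < ‖mpoly k b W‖ * ε ^ k :=
    hc.continuousAt.eventually_lt continuousAt_const (by simpa [h0] using hpos)
  filter_upwards [hev] with A hA
  by_contra! hno
  refine absurd hA (not_lt.2 ?_)
  set Q := linePoly k b A W with hQ
  have hlc : Q.coeff k = mpoly k b W := coeff_linePoly_top hk b A W
  have hdeg : Q.natDegree = k :=
    le_antisymm (natDegree_linePoly_le hk b A W)
      (Polynomial.le_natDegree_of_ne_zero (by rw [hlc]; exact hW))
  have hQ0 : Q ≠ 0 := by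
    rintro h
    rw [h, Polynomial.coeff_zero] at hlc
    exact hW hlc.symm
  have hcard : Q.roots.card = k := by
    rw [← hdeg]; exact (IsAlgClosed.splits Q).natDegree_eq_card_roots.symm
  rw [← eval_linePoly, ← hQ, (IsAlgClosed.splits Q).eval_eq_prod_roots, norm_mul,
    Polynomial.leadingCoeff, hdeg, hlc]
  refine mul_le_mul_of_nonneg_left ?_ (norm_nonneg _)
  have key : ∀ s : Multiset ℂ, (∀ r ∈ s, ε ≤ ‖t₀ - r‖) →
      ε ^ s.card ≤ ‖(s.map fun x => t₀ - x).prod‖ := by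
    intro s
    induction s using Multiset.induction_on with
    | empty => simp
    | cons a s ih =>
      intro hs
      rw [Multiset.card_cons, Multiset.map_cons, Multiset.prod_cons, norm_mul, pow_succ']
      exact mul_le_mul (hs a (Multiset.mem_cons_self a s))
        (ih fun r hr => hs r (Multiset.mem_cons_of_mem hr)) (by positivity) (norm_nonneg _)
  rw [← hcard]
  refine key _ fun r hr => ?_
  by_contra! hlt
  refine hno r ?_ ?_
  · rw [Metric.mem_ball, dist_comm, dist_eq_norm]; exact hlt
  · rw [← eval_linePoly, ← hQ]
    exact (Polynomial.mem_roots'.1 hr).2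

/-- Roots that cannot leave a closed set through its boundary persist along a segment. -/
theorem exists_root_of_homotopy {n k : ℕ} (hk : k ≤ n) (b : Fin n → Mat n) {W A₀ A₁ : Mat n}
    (hW : mpoly k b W ≠ 0) {F G : Set ℂ} (hF : IsClosed F) (hG : IsOpen G) (hGF : G ⊆ F)
    (hFG : ∀ θ : ℝ, 0 ≤ θ → θ ≤ 1 → ∀ t ∈ F,
      mpoly k b (((1 - θ : ℝ) : ℂ) • A₀ + (θ : ℂ) • A₁ + t • W) = 0 → t ∈ G)
    {t₀ : ℂ} (ht₀ : t₀ ∈ F) (h0 : mpoly k b (A₀ + t₀ • W) = 0) :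
    ∃ t ∈ F, mpoly k b (A₁ + t • W) = 0 := by
  set P : ℝ → Mat n := fun θ => ((1 - θ : ℝ) : ℂ) • A₀ + (θ : ℂ) • A₁ with hP
  have hPc : Continuous P := by
    refine Continuous.add ?_ ?_
    · exact (Complex.continuous_ofReal.comp (continuous_const.sub continuous_id)).smul
        continuous_const
    · exact Complex.continuous_ofReal.smul continuous_const
  -- uniform bound for the roots
  obtain ⟨R, hR⟩ : ∃ R : ℝ, ∀ θ ∈ Set.Icc (0 : ℝ) 1, ∀ t : ℂ,
      mpoly k b (P θ + t • W) = 0 → ‖t‖ ≤ R := by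
    -- With `s = 1 / t`, homogeneity turns large roots `t` into small roots `s`; none exist near `s
    -- = 0`, where the value is `mpoly k b W ≠ 0`.
    have hev : ∀ᶠ s : ℂ in 𝓝 0, ∀ θ ∈ Set.Icc (0 : ℝ) 1, mpoly k b (s • P θ + W) ≠ 0 := by
      refine isCompact_Icc.eventually_forall_of_forall_eventually fun θ _ => ?_
      have hc : Continuous fun z : ℂ × ℝ => mpoly k b (z.1 • P z.2 + W) :=
        (continuous_mpoly b).comp
          ((continuous_fst.smul (hPc.comp continuous_snd)).add continuous_const)
      refine hc.continuousAt.eventually_ne ?_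
      simpa using hW
    obtain ⟨δ, hδ, hball⟩ := Metric.eventually_nhds_iff.1 hev
    refine ⟨δ⁻¹, fun θ hθ t ht => ?_⟩
    by_contra! hlt
    have ht0 : t ≠ 0 := by
      rintro rfl
      rw [norm_zero] at hlt
      exact absurd hlt (not_lt.2 (inv_nonneg.2 hδ.le))
    have hs : dist t⁻¹ 0 < δ := by
      rw [dist_zero_right, norm_inv]
      exact inv_lt_of_inv_lt₀ hδ hlt
    refine hball hs θ hθ ?_
    have e : t⁻¹ • P θ + W = t⁻¹ • (P θ + t • W) := by
      rw [smul_add t⁻¹ (P θ), smul_smul t⁻¹ t, inv_mul_cancel₀ ht0, one_smul]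
    rw [e, mpoly_smul hk, ht, mul_zero]
  set S : Set ℝ := {θ | ∃ t ∈ F, mpoly k b (P θ + t • W) = 0} with hS
  have hclosed : IsClosed (S ∩ Set.Icc 0 1) := by
    have hc : Continuous fun z : ℝ × ℂ => mpoly k b (P z.1 + z.2 • W) :=
      (continuous_mpoly b).comp
        ((hPc.comp continuous_fst).add (continuous_snd.smul continuous_const))
    have hcomp : IsCompact ((Set.Icc (0 : ℝ) 1 ×ˢ (Metric.closedBall (0 : ℂ) R ∩ F)) ∩
        {z | mpoly k b (P z.1 + z.2 • W) = 0}) :=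
      (isCompact_Icc.prod ((isCompact_closedBall _ _).inter_right hF)).inter_right
        (isClosed_eq hc continuous_const)
    have e : S ∩ Set.Icc 0 1 = Prod.fst '' ((Set.Icc (0 : ℝ) 1 ×ˢ
        (Metric.closedBall (0 : ℂ) R ∩ F)) ∩ {z | mpoly k b (P z.1 + z.2 • W) = 0}) := by
      ext θ
      constructor
      · rintro ⟨⟨t, htF, ht⟩, hθ⟩
        exact ⟨(θ, t), ⟨⟨hθ, by simpa using hR θ hθ t ht, htF⟩, ht⟩, rfl⟩
      · rintro ⟨⟨θ', t⟩, ⟨⟨hθ, -, htF⟩, ht⟩, rfl⟩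
        exact ⟨⟨t, htF, ht⟩, hθ⟩
    rw [e]
    exact (hcomp.image continuous_fst).isClosed
  -- Real induction: roots in `F` already lie in the open set `G`, so continuity of roots keeps
  -- nearby parameters in `S`.
  have h1 : (1 : ℝ) ∈ S := by
    refine hclosed.Icc_subset_of_forall_mem_nhdsWithin ?_ ?_ (Set.right_mem_Icc.2 zero_le_one)
    · exact ⟨t₀, ht₀, by simpa [hP] using h0⟩
    · rintro θ ⟨⟨t, htF, ht⟩, hθ⟩
      have htG : t ∈ G := hFG θ hθ.1 hθ.2.le t htF ht
      obtain ⟨ε, hε, hball⟩ := Metric.isOpen_iff.1 hG t htG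
      refine mem_nhdsWithin_of_mem_nhds ?_
      filter_upwards [hPc.continuousAt.eventually (eventually_exists_root hk b hW ht hε)]
        with θ' ⟨t', ht', h'⟩
      exact ⟨t', hGF (hball ht'), h'⟩
  obtain ⟨t, htF, ht⟩ := h1
  exact ⟨t, htF, by simpa [hP] using ht⟩

/-- The hyperbolicity cone of `mpoly k b` in the direction of the identity. -/
def hypCone {n : ℕ} (k : ℕ) (b : Fin n → Mat n) : Set (Mat n) :=
  {c | c.IsHermitian ∧ ∀ t : ℝ, 0 ≤ t → mpoly k b (c + (t : ℂ) • 1) ≠ 0}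

/-- The open half-line spanned by the identity matrix. -/
def idRay (n : ℕ) : Set (Mat n) := {A | ∃ t : ℝ, 0 < t ∧ A = (t : ℂ) • (1 : Mat n)}

theorem smul_mem_hypCone {n k : ℕ} (hk : k ≤ n) {b : Fin n → Mat n} {c : Mat n}
    (hc : c ∈ hypCone k b) {s : ℝ} (hs : 0 < s) : (s : ℂ) • c ∈ hypCone k b := by
  refine ⟨isHermitian_real_smul hc.1 s, fun t ht => ?_⟩
  have hs' : (s : ℂ) ≠ 0 := by exact_mod_cast hs.ne'
  have e : (s : ℂ) • c + (t : ℂ) • (1 : Mat n) = (s : ℂ) • (c + ((t / s : ℝ) : ℂ) • 1) := by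
    rw [smul_add, smul_smul]
    congr 2
    push_cast
    field_simp
  rw [e, mpoly_smul hk]
  exact mul_ne_zero (pow_ne_zero _ hs') (hc.2 _ (by positivity))

theorem re_add_im_smul {n : ℕ} (t : ℂ) (W : Mat n) :
    t • W = (t.re : ℂ) • W + Complex.I • ((t.im : ℂ) • W) := by
  conv_lhs => rw [← Complex.re_add_im t]
  rw [add_smul, mul_comm, mul_smul]

/-- A root of the restriction to a real line in a direction of hyperbolicity is real. -/
theorem NonvanishingOnTube.im_eq_zero {n k : ℕ} (hk : k ≤ n) {b : Fin n → Mat n}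
    {C : Set (Mat n)} (h : NonvanishingOnTube k b C) {x W : Mat n} (hx : x.IsHermitian)
    (hWh : W.IsHermitian) (hW : ∀ s : ℝ, 0 < s → (s : ℂ) • W ∈ C) {t : ℂ}
    (h0 : mpoly k b (x + t • W) = 0) : t.im = 0 := by
  have hx' := hx.add (isHermitian_real_smul hWh t.re)
  rw [re_add_im_smul, ← add_assoc] at h0
  rcases lt_trichotomy t.im 0 with h' | h' | h'
  · refine absurd h0 ?_
    have := h.neg hk hx' (hW (-t.im) (by linarith))
    push_cast at this
    rwa [neg_smul, smul_neg, sub_neg_eq_add] at this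
  · exact h'
  · exact absurd h0 (h _ hx' _ (hW _ h'))

/-- Let `i` be a root of `x + t c`. Perturbing by `iσ • 1` keeps a root with `Im t ≥ 0`, and no root
can cross the real axis while `x` is deformed to `0`, since at real `t` the point lies in the tube
over the identity ray. At the end `iσ • 1 + t c` is a zero, so `τ = iσ / t` is a root of `c + τ •
1`. It is real, and negative because `c` is in the cone; this forces `Im t < 0`, a contradiction. -/
theorem NonvanishingOnTube.hypCone {n k : ℕ} (hk : k ≤ n) {b : Fin n → Mat n}
    (h : NonvanishingOnTube k b (idRay n)) : NonvanishingOnTube k b (hypCone k b) := by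
  have hray : ∀ s : ℝ, 0 < s → (s : ℂ) • (1 : Mat n) ∈ idRay n := fun s hs => ⟨s, hs, rfl⟩
  intro x hx c hc h0
  have hc0 : mpoly k b c ≠ 0 := by simpa using hc.2 0 le_rfl
  have hev := eventually_exists_root hk b hc0 (t₀ := Complex.I) h0 one_pos
  have htend : Tendsto (fun σ : ℝ => x + (Complex.I * σ) • (1 : Mat n)) (𝓝[>] 0) (𝓝 x) := by
    have hcont : Continuous fun σ : ℝ => x + (Complex.I * σ) • (1 : Mat n) :=
      continuous_const.add
        ((continuous_const.mul Complex.continuous_ofReal).smul continuous_const)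
    have := hcont.tendsto 0
    simp only [Complex.ofReal_zero, mul_zero, zero_smul, add_zero] at this
    exact this.mono_left nhdsWithin_le_nhds
  obtain ⟨σ, ⟨t₀, ht₀, hroot⟩, hσ⟩ :=
    ((htend.eventually hev).and self_mem_nhdsWithin).exists
  have hσ : 0 < σ := hσ
  have ht₀im : 0 ≤ t₀.im := by
    have h1 : |(t₀ - Complex.I).im| < 1 :=
      (Complex.abs_im_le_norm _).trans_lt (by rwa [← dist_eq_norm])
    rw [Complex.sub_im, Complex.I_im] at h1
    linarith [(abs_lt.1 h1).1]
  obtain ⟨t, htF, ht⟩ := exists_root_of_homotopy hk b (A₀ := x + (Complex.I * σ) • (1 : Mat n))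
    (A₁ := (Complex.I * σ) • (1 : Mat n)) hc0 (F := {z : ℂ | 0 ≤ z.im}) (G := {z : ℂ | 0 < z.im})
    (isClosed_le continuous_const Complex.continuous_im)
    (isOpen_lt continuous_const Complex.continuous_im) (fun z (hz : 0 < z.im) => hz.le)
    (by
      intro θ hθ0 hθ1 t htF ht
      refine lt_of_le_of_ne (show 0 ≤ t.im from htF) fun him => ?_
      have e : ((1 - θ : ℝ) : ℂ) • (x + (Complex.I * σ) • (1 : Mat n)) +
          (θ : ℂ) • ((Complex.I * σ) • (1 : Mat n)) + t • c =
          (((1 - θ : ℝ) : ℂ) • x + (t.re : ℂ) • c) + Complex.I • ((σ : ℂ) • (1 : Mat n)) := by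
        rw [re_add_im_smul t c, ← him]
        push_cast
        simp only [zero_smul, smul_zero, add_zero]
        module
      rw [e] at ht
      exact h _ ((isHermitian_real_smul hx _).add (isHermitian_real_smul hc.1 _)) _
        (hray σ hσ) ht)
    ht₀im hroot
  have ht0 : t ≠ 0 := by
    rintro rfl
    rw [zero_smul, add_zero, mul_smul] at ht
    refine h 0 Matrix.isHermitian_zero _ (hray σ hσ) ?_
    rwa [zero_add]
  have hroot' : mpoly k b (c + (Complex.I * σ / t) • (1 : Mat n)) = 0 := by
    have e : (Complex.I * σ) • (1 : Mat n) + t • c =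
        t • (c + (Complex.I * σ / t) • (1 : Mat n)) := by
      rw [smul_add, smul_smul, mul_div_cancel₀ _ ht0, add_comm]
    rw [e, mpoly_smul hk] at ht
    exact (mul_eq_zero.1 ht).resolve_left (pow_ne_zero _ ht0)
  have him := h.im_eq_zero hk hc.1 Matrix.isHermitian_one hray hroot'
  have hre : Complex.I * σ / t = ((Complex.I * σ / t).re : ℂ) := by
    apply Complex.ext <;> simp [him]
  set τ := (Complex.I * σ / t).re
  rw [hre] at hroot'
  have hτ : τ < 0 := by
    by_contra! h'
    exact hc.2 τ h' hroot'
  have h2 : Complex.I * σ = τ * t := by rw [← hre]; field_simp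
  have h3 := congrArg Complex.im h2
  simp at h3
  have : 0 ≤ t.im := htF
  nlinarith

/-- Deform `c` to `1`. Roots in the direction `d` are real, and none passes through `0` because the
segment from `c` to `1` has no zeros. A nonnegative root would thus survive to `1 + t d`, against `d
∈ hypCone`. This is the source of convexity of the cone. -/
theorem mpoly_ne_zero_of_mem_hypCone {n k : ℕ} (hk : k ≤ n) {b : Fin n → Mat n}
    (h : NonvanishingOnTube k b (idRay n)) {c d : Mat n} (hc : c ∈ hypCone k b)
    (hd : d ∈ hypCone k b) {t₀ : ℝ} (ht₀ : 0 ≤ t₀) : mpoly k b (c + (t₀ : ℂ) • d) ≠ 0 := by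
  intro h0
  have hd0 : mpoly k b d ≠ 0 := by simpa using hd.2 0 le_rfl
  have h1 : mpoly k b 1 ≠ 0 := h.mpoly_ne_zero hk ⟨1, one_pos, by simp⟩
  have hdray : ∀ s : ℝ, 0 < s → (s : ℂ) • d ∈ MSubh.hypCone k b :=
    fun s hs => smul_mem_hypCone hk hd hs
  have hh := h.hypCone hk
  obtain ⟨t, htF, ht⟩ := exists_root_of_homotopy hk b (A₀ := c) (A₁ := 1) hd0
    (F := {z : ℂ | 0 ≤ z.re}) (G := {z : ℂ | 0 < z.re})
    (isClosed_le continuous_const Complex.continuous_re)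
    (isOpen_lt continuous_const Complex.continuous_re) (fun z (hz : 0 < z.re) => hz.le)
    (by
      intro θ hθ0 hθ1 t htF ht
      refine lt_of_le_of_ne (show 0 ≤ t.re from htF) fun hre => ?_
      have him := hh.im_eq_zero hk ((isHermitian_real_smul hc.1 _).add
        (isHermitian_real_smul Matrix.isHermitian_one _)) hd.1 hdray ht
      have ht0 : t = 0 := Complex.ext hre.symm him
      rw [ht0, zero_smul, add_zero] at ht
      rcases hθ1.eq_or_lt with rfl | hlt
      · simp at ht; exact h1 ht
      · have h2 : (0 : ℝ) < 1 - θ := by linarith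
        exact (smul_mem_hypCone hk hc h2).2 θ hθ0 ht)
    (t₀ := (t₀ : ℂ)) (by simpa using ht₀) h0
  have him := hh.im_eq_zero hk Matrix.isHermitian_one hd.1 hdray ht
  have hre : t = (t.re : ℂ) := by apply Complex.ext <;> simp [him]
  have htF : 0 ≤ t.re := htF
  rw [hre] at ht
  rcases htF.eq_or_lt with h' | h'
  · rw [← h'] at ht
    simp at ht
    exact h1 ht
  · refine (hdray t.re h').2 1 zero_le_one ?_
    rw [add_comm]
    simpa using ht

theorem isHermCone_hypCone {n k : ℕ} (hk : k ≤ n) {b : Fin n → Mat n}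
    (h : NonvanishingOnTube k b (idRay n)) : IsHermCone (hypCone k b) where
  herm _ hA := hA.1
  add A hA B hB := by
    refine ⟨hA.1.add hB.1, fun t ht => ?_⟩
    have hA' : A + (t : ℂ) • 1 ∈ hypCone k b := by
      refine ⟨hA.1.add (isHermitian_real_smul Matrix.isHermitian_one t), fun s hs => ?_⟩
      rw [add_assoc, ← add_smul]
      exact_mod_cast hA.2 (t + s) (by positivity)
    have := mpoly_ne_zero_of_mem_hypCone hk h hA' hB zero_le_one
    rw [Complex.ofReal_one, one_smul, add_right_comm] at this
    exact this
  smul A hA t ht := smul_mem_hypCone hk hA ht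


/-! ### From positive definite matrices to positivity of mixed discriminants on `Γ_m` -/

open scoped ComplexOrder in
theorem isHermCone_posDef (n : ℕ) : IsHermCone {A : Mat n | A.PosDef} where
  herm _ hA := hA.1
  add _ hA _ hB := Matrix.PosDef.add hA hB
  smul A hA t ht := Matrix.PosDef.smul hA (by exact_mod_cast ht)

-- For a kernel vector `v` of `x + i y`, the imaginary part of `v* (x + i y) v` is `v* y v > 0`,
-- since `v* x v` is real.
open scoped ComplexOrder in
theorem nonvanishingOnTube_posDef {n : ℕ} (b : Fin n → Mat n) :
    NonvanishingOnTube n b {A : Mat n | A.PosDef} := by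
  intro x hx y hy h0
  have hs : slots n b (x + Complex.I • y) = fun _ => x + Complex.I • y := by
    funext i
    simp [slots]
  rw [mpoly, hs, mixedDisc_const] at h0
  obtain ⟨v, hv, hxv⟩ := Matrix.exists_mulVec_eq_zero_iff.2 h0
  have h1 : star v ⬝ᵥ (x.mulVec v) + Complex.I * (star v ⬝ᵥ (y.mulVec v)) = 0 := by
    have := congrArg (fun w => star v ⬝ᵥ w) hxv
    simpa [Matrix.add_mulVec, Matrix.smul_mulVec, dotProduct_add, dotProduct_smul] using this
  have h2 : (star v ⬝ᵥ (x.mulVec v)).im = 0 := hx.im_star_dotProduct_mulVec_self v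
  have h3 : 0 < (star v ⬝ᵥ (y.mulVec v)).re :=
    (Complex.pos_iff.1 (Matrix.PosDef.dotProduct_mulVec_pos hy hv)).1
  have h4 := congrArg Complex.im h1
  simp at h4
  rw [h2] at h4
  linarith

theorem NonvanishingOnTube.congr {n k : ℕ} {b b' : Fin n → Mat n} {C : Set (Mat n)}
    (h : NonvanishingOnTube k b C) (hb : ∀ i : Fin n, k ≤ (i : ℕ) → b' i = b i) :
    NonvanishingOnTube k b' C := by
  intro x hx y hy
  have : slots k b' (x + Complex.I • y) = slots k b (x + Complex.I • y) := by
    funext i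
    by_cases hi : (i : ℕ) < k
    · simp [slots, hi]
    · simp [slots, hi, hb i (not_lt.1 hi)]
  rw [mpoly, this]
  exact h x hx y hy

/-- Positivity of the mixed discriminant on a cone of hyperbolicity. -/
theorem NonvanishingOnTube.mixedDisc_pos {n k : ℕ} (hk : k ≤ n) {C : Set (Mat n)}
    (hC : IsHermCone C) (h1 : (1 : Mat n) ∈ C) (h : NonvanishingOnTube k (fun _ => 1) C)
    {b : Fin n → Mat n} (hb : ∀ i : Fin n, (i : ℕ) < k → b i ∈ C)
    (hb1 : ∀ i : Fin n, k ≤ (i : ℕ) → b i = 1) : 0 < (mixedDisc b).re := by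
  -- A path from the identity tuple, of mixed discriminant `1`, to `b`; it suffices that the real
  -- mixed discriminant never vanishes on it.
  set B : ℝ → Fin n → Mat n := fun θ i => ((1 - θ : ℝ) : ℂ) • (1 : Mat n) + (θ : ℂ) • b i with hB
  have hBc : Continuous B := by
    refine continuous_pi fun i => Continuous.add ?_ ?_
    · exact (Complex.continuous_ofReal.comp (continuous_const.sub continuous_id)).smul
        continuous_const
    · exact Complex.continuous_ofReal.smul continuous_const
  have hherm : ∀ i, (b i).IsHermitian := fun i => by
    by_cases hi : (i : ℕ) < k
    · exact hC.herm _ (hb i hi)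
    · rw [hb1 i (not_lt.1 hi)]; exact Matrix.isHermitian_one
  have hne : ∀ θ ∈ Set.Icc (0 : ℝ) 1, (mixedDisc (B θ)).re ≠ 0 := by
    intro θ hθ hre
    have hBC : ∀ i : Fin n, (i : ℕ) < k → B θ i ∈ C := by
      intro i hi
      rcases hθ.1.eq_or_lt with h0 | h0
      · simpa [hB, ← h0] using h1
      rcases hθ.2.eq_or_lt with h2 | h2
      · simpa [hB, h2] using hb i hi
      · exact hC.add _ (hC.smul _ h1 _ (by linarith)) _ (hC.smul _ (hb i hi) _ h0)
    have htube : NonvanishingOnTube k (B θ) C := h.congr fun i hi => by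
      simp only [hB, hb1 i hi, ← add_smul]
      push_cast
      simp
    -- Going down to zero active slots leaves the constant `mixedDisc (B θ)`.
    have h0 := htube.iterate hk hC (Nat.zero_le k) fun i _ hi => hBC i hi
    refine h0 0 Matrix.isHermitian_zero 1 h1 ?_
    have e : slots 0 (B θ) (0 + Complex.I • 1) = B θ := by
      funext i
      simp [slots]
    rw [mpoly, e]
    refine Complex.ext hre (mixedDisc_im _ fun i => ?_)
    exact (isHermitian_real_smul Matrix.isHermitian_one _).add (isHermitian_real_smul (hherm i) _)
  have hcont : ContinuousOn (fun θ => (mixedDisc (B θ)).re) (Set.Icc 0 1) :=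
    (Complex.continuous_re.comp (continuous_mixedDisc.comp hBc)).continuousOn
  have e0 : (mixedDisc (B 0)).re = 1 := by
    have : B 0 = fun _ => (1 : Mat n) := by
      funext i
      simp [hB]
    rw [this, mixedDisc_const, Matrix.det_one, Complex.one_re]
  have e1 : B 1 = b := by
    funext i
    simp [hB]
  by_contra! hle
  obtain ⟨θ, hθ, h0⟩ := intermediate_value_Icc' zero_le_one hcont
    (show (0 : ℝ) ∈ Set.Icc (mixedDisc (B 1)).re (mixedDisc (B 0)).re by
      rw [e0, e1]; exact ⟨hle, zero_le_one⟩)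
  exact hne θ hθ h0

open scoped ComplexOrder in
theorem nonvanishingOnTube_one {n k : ℕ} (hk : k ≤ n) :
    NonvanishingOnTube k (fun _ : Fin n => 1) {A : Mat n | A.PosDef} :=
  (nonvanishingOnTube_posDef _).iterate le_rfl (isHermCone_posDef n) hk
    fun _ _ _ => Matrix.PosDef.one

open scoped ComplexOrder in
theorem nonvanishingOnTube_idRay {n k : ℕ} (hk : k ≤ n) :
    NonvanishingOnTube k (fun _ : Fin n => 1) (idRay n) := by
  rintro x hx y ⟨t, ht, rfl⟩
  exact nonvanishingOnTube_one hk x hx _ ((isHermCone_posDef n).smul _ Matrix.PosDef.one t ht)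

open scoped ComplexOrder in
theorem posDef_mem_hypCone {n k : ℕ} (hk : k ≤ n) {A : Mat n} (hA : A.PosDef) :
    A ∈ hypCone k (fun _ : Fin n => 1) := by
  refine ⟨hA.1, fun t ht => ?_⟩
  have hmem : A + (t : ℂ) • 1 ∈ {A : Mat n | A.PosDef} := by
    rcases ht.eq_or_lt with h | h
    · simpa [← h] using hA
    · exact (isHermCone_posDef n).add _ hA _ ((isHermCone_posDef n).smul _ Matrix.PosDef.one t h)
  exact (nonvanishingOnTube_one hk).mpoly_ne_zero hk hmem

theorem mixedDisc_piecewise_const {n : ℕ} (s : Finset (Fin n)) (A B : Mat n) :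
    mixedDisc (s.piecewise (fun _ => A) (fun _ => B)) =
      mixedDisc (fun i : Fin n => if (i : ℕ) < s.card then A else B) := by
  have hcard : Fintype.card {i : Fin n // (i : ℕ) < s.card} = Fintype.card {i // i ∈ s} := by
    rw [Fintype.card_subtype, card_filter_val_lt (by simpa using s.card_le_univ),
      Fintype.card_coe]
  set e := (Fintype.equivOfCardEq hcard).extendSubtype with he
  rw [← mixedDisc_comp_perm _ e]
  congr 1
  funext i
  by_cases hi : (i : ℕ) < s.card
  · have := (Fintype.equivOfCardEq hcard).extendSubtype_mem i hi
    simp [Finset.piecewise, hi, he, this]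
  · have := (Fintype.equivOfCardEq hcard).extendSubtype_not_mem i hi
    simp [Finset.piecewise, hi, he, this]

/-- Multilinear expansion of the value at `s • 1 + H` has coefficients that are the mixed
discriminants of `H` and `1` defining `Γ_m`. All terms are nonnegative, and the empty subset
contributes `s ^ m > 0`. -/
theorem add_smul_one_mem_hypCone {n m : ℕ} (hm : m ≤ n) {H : Mat n} (hH : H ∈ gardingCone n m)
    {ε : ℝ} (hε : 0 < ε) : H + (ε : ℂ) • 1 ∈ hypCone m (fun _ : Fin n => 1) := by
  refine ⟨hH.1.add (isHermitian_real_smul Matrix.isHermitian_one ε), fun t ht h0 => ?_⟩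
  rw [add_assoc, ← add_smul, ← Complex.ofReal_add, add_comm H] at h0
  have hs : 0 < ε + t := by linarith
  generalize ε + t = s at h0 hs
  have hslots : slots m (fun _ : Fin n => (1 : Mat n)) ((s : ℂ) • 1 + H) =
      (fun i : Fin n => (if (i : ℕ) < m then (s : ℂ) else 1) • (1 : Mat n)) +
        slots m (fun _ => 0) H := by
    funext i
    by_cases hi : (i : ℕ) < m <;> simp [slots, hi]
  have hre := congrArg Complex.re h0
  rw [mpoly, hslots, add_comm, ← mixedDiscMulti_apply, MultilinearMap.map_add_univ, Complex.re_sum,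
    Complex.zero_re] at hre
  have hterm : ∀ S : Finset (Fin n), 0 ≤ (mixedDiscMulti n (S.piecewise (slots m (fun _ => 0) H)
      (fun i : Fin n => (if (i : ℕ) < m then (s : ℂ) else 1) • (1 : Mat n)))).re := by
    intro S
    by_cases hS : ∃ i ∈ S, ¬ (i : ℕ) < m
    · obtain ⟨i, hi, him⟩ := hS
      rw [MultilinearMap.map_coord_zero _ i (by simp [hi, slots, him])]
      simp
    · push Not at hS
      have e : S.piecewise (slots m (fun _ => 0) H)
          (fun i : Fin n => (if (i : ℕ) < m then (s : ℂ) else 1) • (1 : Mat n)) =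
          fun i => (((if i ∈ S then 1 else if (i : ℕ) < m then s else 1 : ℝ)) : ℂ) •
            S.piecewise (fun _ => H) (fun _ => 1) i := by
        funext i
        by_cases hi : i ∈ S
        · simp [hi, slots, hS i hi]
        · by_cases him : (i : ℕ) < m <;> simp [hi, him]
      rw [e, MultilinearMap.map_smul_univ, mixedDiscMulti_apply, mixedDisc_piecewise_const,
        ← Complex.ofReal_prod, smul_eq_mul, Complex.re_ofReal_mul]
      refine mul_nonneg (Finset.prod_nonneg fun i _ => by split_ifs <;> positivity) ?_
      rcases Nat.eq_zero_or_pos S.card with h | h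
      · simp [h, mixedDisc_const]
      · refine hH.2 S.card h ?_
        rw [← card_filter_val_lt hm]
        exact Finset.card_le_card fun i hi => by simpa using hS i hi
  have h1 := (Finset.sum_eq_zero_iff_of_nonneg fun S _ => hterm S).1 hre ∅ (Finset.mem_univ _)
  rw [Finset.piecewise_empty, MultilinearMap.map_smul_univ, mixedDiscMulti_apply,
    mixedDisc_const] at h1
  simp only [Matrix.det_one, smul_eq_mul, mul_one] at h1
  rw [show (∏ i : Fin n, if (i : ℕ) < m then (s : ℂ) else 1) =
      ((∏ i : Fin n, if (i : ℕ) < m then s else 1 : ℝ) : ℂ) by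
      rw [Complex.ofReal_prod]; exact Finset.prod_congr rfl fun i _ => by split_ifs <;> simp,
    Complex.ofReal_re] at h1
  exact (Finset.prod_pos fun i _ => by split_ifs <;> positivity).ne' h1

open scoped ComplexOrder in
/-- **Gårding's inequality** for the cones `Γ_m`. -/
theorem garding_inequality {n m : ℕ} (hm : 1 ≤ m) (hmn : m ≤ n) {P : Mat n}
    (hP : P.PosSemidef) {H : ℕ → Mat n} (hH : ∀ k, H k ∈ gardingCone n m) :
    0 ≤ (mixedDisc (fun i : Fin n =>
      if (i : ℕ) = 0 then P else if (i : ℕ) < m then H i else 1)).re := by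
  -- `P` and the `H i` are only limits of elements of the open cone; the strict inequality holds
  -- after adding `ε • 1`, and `ε → 0` gives the weak one.
  set B : ℝ → Fin n → Mat n := fun ε i => if (i : ℕ) = 0 then P + (ε : ℂ) • 1 else
    if (i : ℕ) < m then H i + (ε : ℂ) • 1 else 1 with hB
  have hpos : ∀ ε : ℝ, 0 < ε → 0 < (mixedDisc (B ε)).re := by
    intro ε hε
    refine NonvanishingOnTube.mixedDisc_pos hmn
      (isHermCone_hypCone hmn (nonvanishingOnTube_idRay hmn))
      (posDef_mem_hypCone hmn Matrix.PosDef.one)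
      ((nonvanishingOnTube_idRay hmn).hypCone hmn) (fun i hi => ?_) (fun i hi => ?_)
    · by_cases hi0 : (i : ℕ) = 0
      · simp only [hB, hi0, if_true]
        exact posDef_mem_hypCone hmn (Matrix.PosDef.posSemidef_add hP
          ((isHermCone_posDef n).smul _ Matrix.PosDef.one ε hε))
      · simp only [hB, hi0, if_false, hi, if_true]
        exact add_smul_one_mem_hypCone hmn (hH i) hε
    · have h0 : (i : ℕ) ≠ 0 := by omega
      simp [hB, h0, not_lt.2 hi]
  have hBc : Continuous B := by
    refine continuous_pi fun i => ?_
    simp only [hB]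
    have hs : Continuous fun ε : ℝ => (ε : ℂ) • (1 : Mat n) :=
      Complex.continuous_ofReal.smul continuous_const
    split_ifs
    · exact continuous_const.add hs
    · exact continuous_const.add hs
    · exact continuous_const
  have hcont : Continuous fun ε : ℝ => (mixedDisc (B ε)).re :=
    Complex.continuous_re.comp (continuous_mixedDisc.comp hBc)
  have htend := (hcont.tendsto 0).mono_left (nhdsWithin_le_nhds (s := Set.Ioi 0))
  have h0 : B 0 = fun i : Fin n =>
      if (i : ℕ) = 0 then P else if (i : ℕ) < m then H i else 1 := by
    funext i
    simp [hB]
  rw [← h0]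
  exact ge_of_tendsto htend (eventually_mem_nhdsWithin.mono fun ε hε => (hpos ε hε).le)


/-! ### Sums of second directional derivatives and second differences -/

section SecondDifferences

variable {E : Type*} [NormedAddCommGroup E] [NormedSpace ℝ E] {ι : Type*} [Fintype ι]

/-- The degenerate Laplacian `∑ j, ∂_{w j} ∂_{w j} φ`. -/
def sqLap (w : ι → E) (φ : E → ℝ) (z : E) : ℝ :=
  ∑ j, fderiv ℝ (fderiv ℝ φ) z (w j) (w j)

/-- The second difference with step `t` corresponding to `sqLap`. -/
def secDiff (w : ι → E) (t : ℝ) (f : E → ℝ) (z : E) : ℝ :=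
  ∑ j, (f (z + t • w j) + f (z - t • w j) - 2 * f z)

theorem continuous_snd_fderiv {φ : E → ℝ} (hφ : ContDiff ℝ 2 φ) :
    Continuous (fderiv ℝ (fderiv ℝ φ)) := by
  have h1 : ContDiff ℝ 1 (fderiv ℝ φ) := hφ.fderiv_right (by norm_num)
  exact h1.continuous_fderiv (by norm_num)

theorem continuous_sqLap {φ : E → ℝ} (hφ : ContDiff ℝ 2 φ) (w : ι → E) :
    Continuous (sqLap w φ) :=
  continuous_finsetSum _ fun _ _ =>
    ((continuous_snd_fderiv hφ).clm_apply continuous_const).clm_apply continuous_const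

theorem sqLap_eq_zero {φ : E → ℝ} (w : ι → E) {z : E} (hz : z ∉ tsupport φ) :
    sqLap w φ z = 0 := by
  have h : fderiv ℝ (fderiv ℝ φ) z = 0 :=
    image_eq_zero_of_notMem_tsupport fun h =>
      hz (tsupport_fderiv_subset ℝ (tsupport_fderiv_subset ℝ h))
  simp [sqLap, h]

theorem hasCompactSupport_sqLap {φ : E → ℝ} (hφ : HasCompactSupport φ) (w : ι → E) :
    HasCompactSupport (sqLap w φ) :=
  HasCompactSupport.intro' hφ.isCompact hφ.isCompact.isClosed fun _ hz => sqLap_eq_zero w hz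

theorem sqLap_comp_sub (w : ι → E) (φ : E → ℝ) (a z : E) :
    sqLap w (fun y => φ (y - a)) z = sqLap w φ (z - a) := by
  have h1 : fderiv ℝ (fun y => φ (y - a)) = fun y => fderiv ℝ φ (y - a) :=
    funext fun y => fderiv_comp_sub (f := φ) a
  unfold sqLap
  rw [h1, fderiv_comp_sub (f := fderiv ℝ φ) a]

/-- Uniform second order Taylor approximation along a direction. -/
theorem exists_secDiff_approx_dir {φ : E → ℝ} (hφ : ContDiff ℝ 2 φ) (hc : HasCompactSupport φ)
    (w : E) {η : ℝ} (hη : 0 < η) : ∃ δ > 0, ∀ t : ℝ, 0 < t → t < δ → ∀ z : E,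
      |φ (z + t • w) + φ (z - t • w) - 2 * φ z -
        t ^ 2 * fderiv ℝ (fderiv ℝ φ) z w w| ≤ η * t ^ 2 := by
  set D : E → ℝ := fun z => fderiv ℝ (fderiv ℝ φ) z w w with hD
  have hDc : Continuous D :=
    ((continuous_snd_fderiv hφ).clm_apply continuous_const).clm_apply continuous_const
  have hDs : HasCompactSupport D := by
    refine HasCompactSupport.intro' hc.isCompact hc.isCompact.isClosed fun z hz => ?_
    have := sqLap_eq_zero (fun _ : Unit => w) hz
    simpa [sqLap] using this
  have hUC := hDs.uniformContinuous_of_continuous hDc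
  obtain ⟨δ₀, hδ₀, hδ⟩ := Metric.uniformContinuous_iff.1 hUC (η / 2) (by positivity)
  refine ⟨δ₀ / (‖w‖ + 1), by positivity, fun t ht htδ z => ?_⟩
  have hnear : ∀ s : ℝ, |s| ≤ t → |D (z + s • w) - D z| ≤ η / 2 := by
    intro s hs
    have : dist (z + s • w) z < δ₀ := by
      rw [dist_eq_norm, add_sub_cancel_left, norm_smul, Real.norm_eq_abs]
      calc |s| * ‖w‖ ≤ t * (‖w‖ + 1) := by
            apply mul_le_mul hs (by linarith) (norm_nonneg _) ht.le
        _ < δ₀ := by rwa [lt_div_iff₀ (by positivity)] at htδ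
    have := hδ this
    rw [Real.dist_eq] at this
    exact this.le
  have hline : ∀ s : ℝ, HasDerivAt (fun s : ℝ => z + s • w) w s := fun s => by
    simpa using ((hasDerivAt_id s).smul_const w).const_add z
  have hd1 : ∀ s : ℝ, HasDerivAt (fun s : ℝ => φ (z + s • w)) (fderiv ℝ φ (z + s • w) w) s :=
    fun s => ((hφ.differentiable (by norm_num)) _).hasFDerivAt.comp_hasDerivAt s (hline s)
  have hφ1 : ContDiff ℝ 1 (fderiv ℝ φ) := hφ.fderiv_right (by norm_num)
  have hd2 : ∀ s : ℝ, HasDerivAt (fun s : ℝ => fderiv ℝ φ (z + s • w) w) (D (z + s • w)) s := by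
    intro s
    have h1 := ((hφ1.differentiable (by norm_num)) (z + s • w)).hasFDerivAt.comp_hasDerivAt s
      (hline s)
    exact h1.clm_apply (hasDerivAt_const s w) |>.congr_deriv (by simp [hD])
  have hneg : ∀ {f : ℝ → ℝ} {f' s : ℝ}, HasDerivAt f f' (-s) →
      HasDerivAt (fun s => f (-s)) (-f') s := fun {_ _ s} h =>
    (h.comp s (hasDerivAt_neg s)).congr_deriv (by simp)
  -- `g1` is the derivative of the Taylor remainder `g`, and the derivative of `g1` is at most `η`
  -- in size; two mean value estimates give `η * t ^ 2`.
  set g1 : ℝ → ℝ := fun s => fderiv ℝ φ (z + s • w) w - fderiv ℝ φ (z + (-s) • w) w -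
    2 * s * D z with hg1
  set g : ℝ → ℝ := fun s => φ (z + s • w) + φ (z + (-s) • w) - 2 * φ z - s ^ 2 * D z with hg
  have hgd : ∀ s, HasDerivAt g (g1 s) s := by
    intro s
    have h := (((hd1 s).add (hneg (hd1 (-s)))).sub_const (2 * φ z)).sub
      ((hasDerivAt_pow 2 s).mul_const (D z))
    refine h.congr_deriv ?_
    simp [hg1]
    ring
  have hg1d : ∀ s, HasDerivAt g1 (D (z + s • w) + D (z + (-s) • w) - 2 * D z) s := by
    intro s
    have h := ((hd2 s).sub (hneg (hd2 (-s)))).sub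
      (((hasDerivAt_id s).const_mul 2).mul_const (D z))
    refine h.congr_deriv ?_
    simp
  have hg1b : ∀ s ∈ Set.Icc (0 : ℝ) t, |g1 s| ≤ η * t := by
    intro s hs
    have := norm_image_sub_le_of_norm_deriv_le_segment' (f := g1) (a := 0) (b := t) (C := η)
      (fun x _ => (hg1d x).hasDerivWithinAt) (fun x hx => by
        have h1 := hnear x (by rw [abs_of_nonneg hx.1]; exact hx.2.le)
        have h2 := hnear (-x) (by rw [abs_neg, abs_of_nonneg hx.1]; exact hx.2.le)
        rw [Real.norm_eq_abs, abs_le]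
        rw [abs_le] at h1 h2
        constructor <;> linarith) s hs
    have h0 : g1 0 = 0 := by simp [hg1]
    rw [h0, sub_zero, sub_zero, Real.norm_eq_abs] at this
    exact this.trans (mul_le_mul_of_nonneg_left hs.2 hη.le)
  have := norm_image_sub_le_of_norm_deriv_le_segment' (f := g) (a := 0) (b := t) (C := η * t)
    (fun x _ => (hgd x).hasDerivWithinAt) (fun x hx => by
      rw [Real.norm_eq_abs]; exact hg1b x ⟨hx.1, hx.2.le⟩) t ⟨ht.le, le_rfl⟩
  have h0 : g 0 = 0 := by simp [hg]; ring
  rw [h0, sub_zero, sub_zero, Real.norm_eq_abs] at this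
  simp only [hg, neg_smul, ← sub_eq_add_neg] at this
  exact this.trans_eq (by ring)

theorem exists_secDiff_approx {φ : E → ℝ} (hφ : ContDiff ℝ 2 φ) (hc : HasCompactSupport φ)
    (w : ι → E) {η : ℝ} (hη : 0 < η) : ∃ δ > 0, ∀ t : ℝ, 0 < t → t < δ → ∀ z : E,
      |secDiff w t φ z - t ^ 2 * sqLap w φ z| ≤ η * t ^ 2 := by
  have hη' : 0 < η / (Fintype.card ι + 1) := by positivity
  choose δ hδ0 hδ using fun j => exists_secDiff_approx_dir hφ hc (w j) hη'
  obtain ⟨d, hd0, hd⟩ : ∃ d > 0, ∀ j, d ≤ δ j := by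
    rcases isEmpty_or_nonempty ι with h | h
    · exact ⟨1, one_pos, fun j => isEmptyElim j⟩
    · obtain ⟨j, hj⟩ := Finite.exists_min δ
      exact ⟨δ j, hδ0 j, hj⟩
  refine ⟨d, hd0, fun t ht htd z => ?_⟩
  rw [secDiff, sqLap, Finset.mul_sum, ← Finset.sum_sub_distrib]
  refine (Finset.abs_sum_le_sum_abs _ _).trans ?_
  refine (Finset.sum_le_sum fun j _ => hδ j t ht (htd.trans_le (hd j)) z).trans ?_
  rw [Finset.sum_const, Finset.card_univ, nsmul_eq_mul]
  calc (Fintype.card ι : ℝ) * (η / (Fintype.card ι + 1) * t ^ 2)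
      = (Fintype.card ι / (Fintype.card ι + 1)) * (η * t ^ 2) := by ring
    _ ≤ 1 * (η * t ^ 2) := by
        refine mul_le_mul_of_nonneg_right ?_ (by positivity)
        rw [div_le_one (by positivity)]
        linarith
    _ = η * t ^ 2 := one_mul _

theorem secDiff_continuous {f : E → ℝ} (hf : Continuous f) (w : ι → E) (t : ℝ) :
    Continuous (secDiff w t f) := by
  unfold secDiff
  fun_prop

/-- `f` is asymptotically non-negative on `K` with respect to second differences. -/
def SecDiffNonneg (w : ι → E) (f : E → ℝ) (K : Set E) : Prop :=
  ∀ η > 0, ∃ δ > 0, ∀ t : ℝ, 0 < t → t < δ → ∀ x ∈ K, -(η * t ^ 2) ≤ secDiff w t f x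

/-- At `x` the maximum agrees with the larger function and elsewhere it dominates it, so its second
difference at `x` is at least that of the larger function. -/
theorem SecDiffNonneg.sup {w : ι → E} {f g : E → ℝ} {K : Set E} (hf : SecDiffNonneg w f K)
    (hg : SecDiffNonneg w g K) : SecDiffNonneg w (fun x => max (f x) (g x)) K := by
  intro η hη
  obtain ⟨δ₁, hδ₁, h1⟩ := hf η hη
  obtain ⟨δ₂, hδ₂, h2⟩ := hg η hη
  refine ⟨min δ₁ δ₂, lt_min hδ₁ hδ₂, fun t ht htδ x hx => ?_⟩
  rcases le_total (f x) (g x) with h | h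
  · refine (h2 t ht (htδ.trans_le (min_le_right _ _)) x hx).trans ?_
    refine Finset.sum_le_sum fun j _ => ?_
    simp only [max_eq_right h]
    linarith [le_max_right (f (x + t • w j)) (g (x + t • w j)),
      le_max_right (f (x - t • w j)) (g (x - t • w j))]
  · refine (h1 t ht (htδ.trans_le (min_le_left _ _)) x hx).trans ?_
    refine Finset.sum_le_sum fun j _ => ?_
    simp only [max_eq_left h]
    linarith [le_max_left (f (x + t • w j)) (g (x + t • w j)),
      le_max_left (f (x - t • w j)) (g (x - t • w j))]

variable [MeasurableSpace E] [BorelSpace E] (μ : Measure E) [μ.IsAddHaarMeasure]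

/-- `f` satisfies `sqLap w f ≥ 0` on `U` in the sense of distributions. -/
def WeakNonneg (w : ι → E) (f : E → ℝ) (U : Set E) : Prop :=
  ∀ φ : E → ℝ, ContDiff ℝ ∞ φ → HasCompactSupport φ → tsupport φ ⊆ U → (∀ z, 0 ≤ φ z) →
    0 ≤ ∫ z, f z * sqLap w φ z ∂μ

/-- Discrete integration by parts: translation invariance of `μ` moves each shift from `φ` to `h`.
-/
theorem integral_mul_secDiff {h φ : E → ℝ} (hh : Continuous h) (hhc : HasCompactSupport h)
    (hφ : Continuous φ) (hφc : HasCompactSupport φ) (w : ι → E) (t : ℝ) :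
    ∫ z, h z * secDiff w t φ z ∂μ = ∫ z, secDiff w t h z * φ z ∂μ := by
  have i1 : ∀ a : E, Integrable (fun z => h z * φ (z + a)) μ := fun a =>
    (hh.mul (hφ.comp (continuous_id.add continuous_const))).integrable_of_hasCompactSupport
      hhc.mul_right
  have i2 : ∀ a : E, Integrable (fun z => h (z + a) * φ z) μ := fun a =>
    ((hh.comp (continuous_id.add continuous_const)).mul hφ).integrable_of_hasCompactSupport
      hφc.mul_left
  have e : ∀ a : E, ∫ z, h z * φ (z + a) ∂μ = ∫ z, h (z - a) * φ z ∂μ := fun a => by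
    rw [← integral_add_right_eq_self (fun z => h (z - a) * φ z) a]
    simp
  have i1' : ∀ a : E, Integrable (fun z => h z * φ (z - a)) μ := fun a => by
    simpa [sub_eq_add_neg] using i1 (-a)
  have i2' : ∀ a : E, Integrable (fun z => h (z - a) * φ z) μ := fun a => by
    simpa [sub_eq_add_neg] using i2 (-a)
  have i0 : Integrable (fun z => h z * φ z) μ := by simpa using i1 0
  have split : ∀ {a b c : E → ℝ}, Integrable a μ → Integrable b μ → Integrable c μ →
      ∫ z, (a z + b z - c z) ∂μ = ∫ z, a z ∂μ + ∫ z, b z ∂μ - ∫ z, c z ∂μ :=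
    fun {a b c} ha hb hc => by
      rw [integral_sub (f := fun z => a z + b z) (ha.add hb) hc, integral_add ha hb]
  simp only [secDiff, Finset.mul_sum, Finset.sum_mul]
  rw [integral_finsetSum, integral_finsetSum]
  · refine Finset.sum_congr rfl fun j _ => ?_
    have e1 := e (t • w j)
    have e2 := e (-(t • w j))
    simp only [← sub_eq_add_neg, sub_neg_eq_add] at e2
    calc ∫ z, h z * (φ (z + t • w j) + φ (z - t • w j) - 2 * φ z) ∂μ
        = ∫ z, (h z * φ (z + t • w j) + h z * φ (z - t • w j) - 2 * (h z * φ z)) ∂μ := by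
          congr 1; funext z; ring
      _ = ∫ z, h z * φ (z + t • w j) ∂μ + ∫ z, h z * φ (z - t • w j) ∂μ -
          ∫ z, 2 * (h z * φ z) ∂μ := by
          exact split (i1 _) (i1' _) (i0.const_mul 2)
      _ = ∫ z, h (z + t • w j) * φ z ∂μ + ∫ z, h (z - t • w j) * φ z ∂μ -
          ∫ z, 2 * (h z * φ z) ∂μ := by rw [e1, e2]; ring
      _ = ∫ z, (h (z + t • w j) * φ z + h (z - t • w j) * φ z - 2 * (h z * φ z)) ∂μ := by
          exact (split (i2 _) (i2' _) (i0.const_mul 2)).symm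
      _ = _ := by congr 1; funext z; ring
  · intro j _
    have := ((i2 (t • w j)).add (i2' (t • w j))).sub (i0.const_mul 2)
    refine this.congr (ae_of_all _ fun z => ?_)
    simp only [Pi.add_apply, Pi.sub_apply]
    ring
  · intro j _
    have := ((i1 (t • w j)).add (i1' (t • w j))).sub (i0.const_mul 2)
    refine this.congr (ae_of_all _ fun z => ?_)
    simp only [Pi.add_apply, Pi.sub_apply]
    ring

/-- Up to errors of order `η * t ^ 2`, `t ^ 2 * ∫ h * sqLap w φ` equals `∫ h * secDiff w t φ = ∫
secDiff w t h * φ ≥ 0`; divide by `t ^ 2` and let `η → 0`. -/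
theorem SecDiffNonneg.integral_nonneg {w : ι → E} {h : E → ℝ} {K : Set E}
    (hS : SecDiffNonneg w h K) (hh : Continuous h) (hhc : HasCompactSupport h) {φ : E → ℝ}
    (hφ : ContDiff ℝ 2 φ) (hφc : HasCompactSupport φ) (hK : tsupport φ ⊆ K)
    (h0 : ∀ z, 0 ≤ φ z) : 0 ≤ ∫ z, h z * sqLap w φ z ∂μ := by
  have hφi : Integrable φ μ := hφ.continuous.integrable_of_hasCompactSupport hφc
  have hhi : Integrable (fun z => |h z|) μ := (hh.integrable_of_hasCompactSupport hhc).abs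
  have key : ∀ η > 0, -(η * (∫ z, φ z ∂μ + ∫ z, |h z| ∂μ)) ≤ ∫ z, h z * sqLap w φ z ∂μ := by
    intro η hη
    obtain ⟨δ₁, hδ₁, h1⟩ := hS η hη
    obtain ⟨δ₂, hδ₂, h2⟩ := exists_secDiff_approx hφ hφc w hη
    obtain ⟨t, ht0, htlt⟩ := exists_between (lt_min hδ₁ hδ₂)
    have h1 := h1 t ht0 (htlt.trans_le (min_le_left _ _))
    have h2 := h2 t ht0 (htlt.trans_le (min_le_right _ _))
    have ia : Integrable (fun z => h z * secDiff w t φ z) μ :=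
      (hh.mul (secDiff_continuous hφ.continuous w t)).integrable_of_hasCompactSupport
        hhc.mul_right
    have ib : Integrable (fun z => h z * sqLap w φ z) μ :=
      (hh.mul (continuous_sqLap hφ w)).integrable_of_hasCompactSupport hhc.mul_right
    have ic : Integrable (fun z => secDiff w t h z * φ z) μ :=
      ((secDiff_continuous hh w t).mul hφ.continuous).integrable_of_hasCompactSupport
        hφc.mul_left
    have s1 : -(η * t ^ 2 * ∫ z, φ z ∂μ) ≤ ∫ z, secDiff w t h z * φ z ∂μ := by
      rw [← neg_mul, ← integral_const_mul]
      refine integral_mono (hφi.const_mul _) ic fun z => ?_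
      by_cases hz : z ∈ K
      · have := mul_le_mul_of_nonneg_right (h1 z hz) (h0 z)
        simpa using this
      · have : φ z = 0 := image_eq_zero_of_notMem_tsupport fun h => hz (hK h)
        simp [this]
    have s2 : ∫ z, h z * secDiff w t φ z ∂μ ≤
        t ^ 2 * ∫ z, h z * sqLap w φ z ∂μ + η * t ^ 2 * ∫ z, |h z| ∂μ := by
      rw [← integral_const_mul, ← integral_const_mul, ← integral_add (ib.const_mul _)
        (hhi.const_mul _)]
      refine integral_mono ia ((ib.const_mul _).add (hhi.const_mul _)) fun z => ?_
      have h3 : h z * (secDiff w t φ z - t ^ 2 * sqLap w φ z) ≤ |h z| * (η * t ^ 2) :=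
        (le_abs_self _).trans (by
          rw [abs_mul]; exact mul_le_mul_of_nonneg_left (h2 z) (abs_nonneg _))
      simp only
      linarith
    rw [integral_mul_secDiff μ hh hhc hφ.continuous hφc] at s2
    have ht2 : 0 < t ^ 2 := by positivity
    have s3 := s1.trans s2
    by_contra! hlt
    have := mul_lt_mul_of_pos_left hlt ht2
    linarith
  by_contra! hlt
  set A := ∫ z, φ z ∂μ + ∫ z, |h z| ∂μ with hA
  have hA0 : 0 ≤ A := add_nonneg (MeasureTheory.integral_nonneg h0)
    (MeasureTheory.integral_nonneg fun z => abs_nonneg _)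
  set J := ∫ z, h z * sqLap w φ z ∂μ
  -- This `η` makes the error at most `-J / 2`; the `+ 1` covers `A = 0`.
  have := key (-J / (2 * (A + 1))) (div_pos (by linarith) (by positivity))
  have h3 : -J / (2 * (A + 1)) * A ≤ -J / 2 := by
    rw [div_mul_eq_mul_div, div_le_div_iff₀ (by positivity) (by norm_num)]
    nlinarith
  linarith

end SecondDifferences


/-! ### Cutoff, mollification and maxima for weak inequalities -/

theorem exists_cutoff {E : Type*} [MetricSpace E] [ProperSpace E] {K U : Set E} (hK : IsCompact K) (hU : IsOpen U)
    (hKU : K ⊆ U) :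
    ∃ χ : E → ℝ, Continuous χ ∧ HasCompactSupport χ ∧ tsupport χ ⊆ U ∧ ∀ x ∈ K, χ x = 1 := by
  obtain ⟨W, hW, hKW, hWU, hWc⟩ := exists_open_between_and_isCompact_closure hK hU hKU
  obtain ⟨f, hf1, hf0, hfc, -⟩ := exists_continuous_one_zero_of_isCompact hK hW.isClosed_compl
    (Set.disjoint_compl_right_iff_subset.2 hKW)
  refine ⟨f, f.continuous, hfc, ?_, fun x hx => hf1 hx⟩
  refine (closure_mono fun x hx => ?_).trans hWU
  by_contra h
  exact hx (hf0 h)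

section WeakMax

variable {E : Type*} [NormedAddCommGroup E] [NormedSpace ℝ E] {ι : Type*} [Fintype ι]
  [MeasurableSpace E] [BorelSpace E] [FiniteDimensional ℝ E] (μ : Measure E) [μ.IsAddHaarMeasure]

/-- Mollification: a weakly non-negative function is uniformly approximated by functions that are
asymptotically non-negative for second differences. -/
theorem WeakNonneg.exists_approx {w : ι → E} {u : E → ℝ} {U K : Set E}
    (h : WeakNonneg μ w u U) (hu : Continuous u) (huc : HasCompactSupport u) (hU : IsOpen U)
    (hK : IsCompact K) (hKU : K ⊆ U) {η : ℝ} (hη : 0 < η) :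
    ∃ F : E → ℝ, Continuous F ∧ HasCompactSupport F ∧ (∀ x, |F x - u x| ≤ η) ∧
      SecDiffNonneg w F K := by
  obtain ⟨δ₀, hδ₀, hδ⟩ := Metric.uniformContinuous_iff.1
    (huc.uniformContinuous_of_continuous hu) η hη
  obtain ⟨r₀, hr₀, hr⟩ := hK.exists_cthickening_subset_open hU hKU
  have hr1 : 0 < min δ₀ r₀ := lt_min hδ₀ hr₀
  -- Radius `δ₀` ensures uniform closeness to `u`; radius `r₀` keeps the bumps centred on `K`
  -- supported in `U`.
  let B : ContDiffBump (0 : E) := ⟨min δ₀ r₀ / 2, min δ₀ r₀, by positivity, by linarith⟩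
  set ρ : E → ℝ := B.normed μ with hρ
  have hρs : ContDiff ℝ ∞ ρ := B.contDiff_normed
  have hρ2 : ContDiff ℝ 2 ρ := contDiff_infty.1 hρs 2
  have hρc : HasCompactSupport ρ := B.hasCompactSupport_normed
  have hρsymm : ∀ x, ρ (-x) = ρ x := fun x => by
    have := B.normed_sub (μ := μ) x
    simpa [hρ] using this
  set F : E → ℝ := convolution ρ u (ContinuousLinearMap.lsmul ℝ ℝ) μ with hF
  -- Evenness of the bump turns the mollification into a pairing of `u` with the translate of `ρ`
  -- centred at `x`, an admissible test function for `x ∈ K`.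
  have hFeq : ∀ x, F x = ∫ y, u y * ρ (y - x) ∂μ := fun x => by
    rw [hF, convolution_eq_swap]
    congr 1
    funext y
    rw [← hρsymm, neg_sub]
    simp [mul_comm]
  refine ⟨F, hρc.continuous_convolution_left _ hρs.continuous
    hu.locallyIntegrable, hρc.convolution _ huc, fun x => ?_, ?_⟩
  · have := B.dist_normed_convolution_le (μ := μ) (g := u) (x₀ := x) (ε := η)
      hu.aestronglyMeasurable fun y hy => (hδ (lt_of_lt_of_le hy (min_le_left _ _))).le
    rwa [Real.dist_eq] at this
  · intro η' hη'
    set A := ∫ y, |u y| ∂μ with hA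
    have hA0 : 0 ≤ A := MeasureTheory.integral_nonneg fun y => abs_nonneg _
    have hη1 : 0 < η' / (A + 1) := by positivity
    obtain ⟨δ, hδ0, hδ1⟩ := exists_secDiff_approx hρ2 hρc w hη1
    refine ⟨δ, hδ0, fun t ht htδ x hx => ?_⟩
    have i1 : ∀ a : E, Integrable (fun y => u y * ρ (y - a)) μ := fun a =>
      (hu.mul (hρs.continuous.comp (continuous_id.sub
        continuous_const))).integrable_of_hasCompactSupport huc.mul_right
    have e1 : secDiff w t F x = ∫ y, u y * secDiff w t ρ (y - x) ∂μ := by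
      simp only [secDiff, hFeq, Finset.mul_sum]
      rw [integral_finsetSum]
      · refine Finset.sum_congr rfl fun j _ => ?_
        rw [← integral_add (i1 _) (i1 _), ← integral_const_mul,
          ← integral_sub (f := fun y => u y * ρ (y - (x + t • w j)) + u y * ρ (y - (x - t • w j)))
            ((i1 _).add (i1 _)) ((i1 x).const_mul 2)]
        congr 1
        funext y
        rw [show y - (x + t • w j) = y - x - t • w j by abel,
          show y - (x - t • w j) = y - x + t • w j by abel]
        ring
      · intro j _
        refine Continuous.integrable_of_hasCompactSupport ?_ huc.mul_right
        have := hρs.continuous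
        fun_prop
    have hpos : 0 ≤ ∫ y, u y * sqLap w ρ (y - x) ∂μ := by
      have := h (fun y => ρ (y - x)) (hρs.comp (contDiff_id.sub contDiff_const))
        (hρc.comp_homeomorph (Homeomorph.subRight x)) ?_ fun y => B.nonneg_normed _
      · simpa only [sqLap_comp_sub] using this
      · have hsub : tsupport (fun y => ρ (y - x)) ⊆ Metric.closedBall x (min δ₀ r₀) := by
          refine closure_minimal (fun y hy => ?_) Metric.isClosed_closedBall
          have hy' : y - x ∈ tsupport ρ := subset_tsupport _ hy
          rw [hρ, B.tsupport_normed_eq, Metric.mem_closedBall, dist_zero_right] at hy'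
          rw [Metric.mem_closedBall, dist_eq_norm]
          exact hy'
        refine hsub.trans ((Metric.closedBall_subset_closedBall (min_le_right _ _)).trans
          ((Metric.closedBall_subset_cthickening hx _).trans hr))
    have hb : ∀ y, -(η' / (A + 1) * t ^ 2) * |u y| ≤
        u y * secDiff w t ρ (y - x) - t ^ 2 * (u y * sqLap w ρ (y - x)) := fun y => by
      have h3 : |u y * (secDiff w t ρ (y - x) - t ^ 2 * sqLap w ρ (y - x))| ≤
          |u y| * (η' / (A + 1) * t ^ 2) := by
        rw [abs_mul]; exact mul_le_mul_of_nonneg_left (hδ1 t ht htδ _) (abs_nonneg _)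
      have := (abs_le.1 h3).1
      linarith
    have ib : Integrable (fun y => u y * secDiff w t ρ (y - x)) μ :=
      (hu.mul ((secDiff_continuous hρs.continuous w t).comp (continuous_id.sub
        continuous_const))).integrable_of_hasCompactSupport huc.mul_right
    have ic : Integrable (fun y => u y * sqLap w ρ (y - x)) μ :=
      (hu.mul ((continuous_sqLap hρ2 w).comp (continuous_id.sub
        continuous_const))).integrable_of_hasCompactSupport huc.mul_right
    have id : Integrable (fun y => |u y|) μ := (hu.integrable_of_hasCompactSupport huc).abs
    have := integral_mono (id.const_mul _) (ib.sub (ic.const_mul (t ^ 2))) hb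
    simp only [Pi.sub_apply] at this
    rw [integral_const_mul, integral_sub ib (ic.const_mul (t ^ 2)), integral_const_mul,
      ← e1, ← hA] at this
    have h4 : η' / (A + 1) * t ^ 2 * A ≤ η' * t ^ 2 := by
      rw [div_mul_eq_mul_div, div_mul_eq_mul_div, div_le_iff₀ (by positivity)]
      nlinarith [mul_nonneg hη'.le (sq_nonneg t)]
    have h5 : 0 ≤ t ^ 2 * ∫ y, u y * sqLap w ρ (y - x) ∂μ := by positivity
    linarith

/-- A cutoff equal to `1` near the support of the test function makes `u` and `v` globally
continuous with compact support. Their mollifications satisfy second difference bounds, which pass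
to the maximum; integrating against the test function and letting the uniform error tend to `0`
finishes. -/
theorem WeakNonneg.sup {w : ι → E} {u v : E → ℝ} {U : Set E} (hU : IsOpen U)
    (hu : WeakNonneg μ w u U) (hv : WeakNonneg μ w v U) (huc : ContinuousOn u U)
    (hvc : ContinuousOn v U) : WeakNonneg μ w (fun x => max (u x) (v x)) U := by
  intro φ hφ hφc hφU hφ0
  have : ProperSpace E := FiniteDimensional.proper ℝ E
  have hφ2 : ContDiff ℝ 2 φ := contDiff_infty.1 hφ 2
  obtain ⟨V, hV, hKV, hVU, hVc⟩ :=
    exists_open_between_and_isCompact_closure hφc.isCompact hU hφU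
  obtain ⟨χ, hχ, hχc, hχU, hχ1⟩ := exists_cutoff hVc hU hVU
  have cut : ∀ f : E → ℝ, ContinuousOn f U → WeakNonneg μ w f U →
      Continuous (fun x => χ x * f x) ∧ HasCompactSupport (fun x => χ x * f x) ∧
        WeakNonneg μ w (fun x => χ x * f x) V := by
    intro f hf hw
    refine ⟨?_, hχc.mul_right, ?_⟩
    · refine ContinuousOn.continuous_of_tsupport_subset (s := U) (hχ.continuousOn.mul hf) hU ?_
      exact (tsupport_mul_subset_left).trans hχU
    · intro ψ h1 h2 h3 h4
      have := hw ψ h1 h2 (h3.trans (subset_closure.trans hVU)) h4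
      refine this.trans_eq (integral_congr_ae (ae_of_all _ fun z => ?_))
      by_cases hz : z ∈ tsupport ψ
      · simp only
        rw [hχ1 z (subset_closure (h3 hz)), one_mul]
      · simp [sqLap_eq_zero w hz]
  obtain ⟨cu, su, wu⟩ := cut u huc hu
  obtain ⟨cv, sv, wv⟩ := cut v hvc hv
  have e : ∫ z, max (u z) (v z) * sqLap w φ z ∂μ =
      ∫ z, max (χ z * u z) (χ z * v z) * sqLap w φ z ∂μ := by
    refine integral_congr_ae (ae_of_all _ fun z => ?_)
    by_cases hz : z ∈ tsupport φ
    · simp only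
      rw [hχ1 z (subset_closure (hKV hz)), one_mul, one_mul]
    · simp [sqLap_eq_zero w hz]
  rw [e]
  have hLc := continuous_sqLap hφ2 w
  have hLs := hasCompactSupport_sqLap hφc w
  set A := ∫ z, |sqLap w φ z| ∂μ with hA
  have hA0 : 0 ≤ A := MeasureTheory.integral_nonneg fun y => abs_nonneg _
  have key : ∀ η > 0, -(η * A) ≤ ∫ z, max (χ z * u z) (χ z * v z) * sqLap w φ z ∂μ := by
    intro η hη
    obtain ⟨F, cF, sF, aF, pF⟩ := wu.exists_approx μ cu su hV hφc.isCompact hKV hη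
    obtain ⟨G, cG, sG, aG, pG⟩ := wv.exists_approx μ cv sv hV hφc.isCompact hKV hη
    have sM : HasCompactSupport fun x => max (F x) (G x) := by
      refine HasCompactSupport.intro (sF.isCompact.union sG.isCompact) fun x hx => ?_
      rw [Set.mem_union, not_or] at hx
      simp [image_eq_zero_of_notMem_tsupport hx.1, image_eq_zero_of_notMem_tsupport hx.2]
    have h0 := (pF.sup pG).integral_nonneg μ (cF.max cG) sM hφ2 hφc le_rfl hφ0
    have i1 : Integrable (fun z => max (F z) (G z) * sqLap w φ z) μ :=
      ((cF.max cG).mul hLc).integrable_of_hasCompactSupport hLs.mul_left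
    have i2 : Integrable (fun z => max (χ z * u z) (χ z * v z) * sqLap w φ z) μ :=
      ((cu.max cv).mul hLc).integrable_of_hasCompactSupport hLs.mul_left
    have i3 : Integrable (fun z => |sqLap w φ z|) μ :=
      (hLc.integrable_of_hasCompactSupport hLs).abs
    have := integral_mono (i1.sub (i3.const_mul η)) i2 fun z => by
      have hm : |max (F z) (G z) - max (χ z * u z) (χ z * v z)| ≤ η :=
        (abs_max_sub_max_le_max _ _ _ _).trans (max_le (aF z) (aG z))
      have h3 : |(max (F z) (G z) - max (χ z * u z) (χ z * v z)) * sqLap w φ z| ≤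
          η * |sqLap w φ z| := by
        rw [abs_mul]; exact mul_le_mul_of_nonneg_right hm (abs_nonneg _)
      have := (abs_le.1 h3).2
      simp only [Pi.sub_apply]
      linarith
    simp only [Pi.sub_apply] at this
    rw [integral_sub i1 (i3.const_mul η), integral_const_mul, ← hA] at this
    linarith
  by_contra! hlt
  set J := ∫ z, max (χ z * u z) (χ z * v z) * sqLap w φ z ∂μ
  have := key (-J / (2 * (A + 1))) (div_pos (by linarith) (by positivity))
  have h3 : -J / (2 * (A + 1)) * A ≤ -J / 2 := by
    rw [div_mul_eq_mul_div, div_le_div_iff₀ (by positivity) (by norm_num)]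
    nlinarith
  linarith

/-- Integration by parts against the constant `1`; this is what puts constants into `SHo`. -/
theorem integral_sqLap {φ : E → ℝ} (hφ : ContDiff ℝ 2 φ) (hc : HasCompactSupport φ) (w : ι → E) :
    ∫ z, sqLap w φ z ∂μ = 0 := by
  have hcont := continuous_snd_fderiv hφ
  have hφ1 : ContDiff ℝ 1 (fderiv ℝ φ) := hφ.fderiv_right (by norm_num)
  unfold sqLap
  rw [integral_finsetSum]
  · refine Finset.sum_eq_zero fun j _ => ?_
    set g : E → ℝ := fun z => fderiv ℝ φ z (w j) with hg
    have hg1 : ContDiff ℝ 1 g := hφ1.clm_apply contDiff_const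
    have hgc : HasCompactSupport g := hc.fderiv_apply ℝ (w j)
    have hgd : ∀ z, fderiv ℝ (fderiv ℝ φ) z (w j) (w j) = fderiv ℝ g z (w j) := fun z => by
      rw [hg, fderiv_clm_apply ((hφ1.differentiable (by norm_num)) z)
        (differentiableAt_const _)]
      simp
    have hi : Integrable (fun z => fderiv ℝ g z (w j)) μ :=
      ((hg1.continuous_fderiv (by norm_num)).clm_apply
        continuous_const).integrable_of_hasCompactSupport (hgc.fderiv_apply ℝ (w j))
    have := integral_mul_fderiv_eq_neg_fderiv_mul_of_integrable (μ := μ) (f := fun _ => (1 : ℝ))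
      (g := g) (v := w j) (by simp) (by simpa using hi)
      (by simpa using hg1.continuous.integrable_of_hasCompactSupport hgc)
      (fun x _ => differentiableAt_const _) (fun x _ => (hg1.differentiable (by norm_num)) x)
    simp only [hgd]
    simpa using this
  · intro j _
    refine ((hcont.clm_apply continuous_const).clm_apply
      continuous_const).integrable_of_hasCompactSupport ?_
    have := hasCompactSupport_sqLap hc (fun _ : Unit => w j)
    have e : sqLap (fun _ : Unit => w j) φ = fun z => fderiv ℝ (fderiv ℝ φ) z (w j) (w j) :=
      funext fun z => by simp [sqLap]
    rwa [e] at this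

end WeakMax


/-! ### The operators `hessianDensity` as sums of squares -/

theorem complexHessian_isHermitian {n : ℕ} {φ : Cn n → ℝ} (hφ : ContDiff ℝ 2 φ) (z : Cn n) :
    (complexHessian φ z).IsHermitian := by
  have hs : ∀ v w : Cn n, secondDeriv φ z v w = secondDeriv φ z w v := fun v w =>
    (hφ.contDiffAt.isSymmSndFDerivAt (by simp)) v w
  ext j k
  rw [Matrix.conjTranspose_apply]
  simp only [complexHessian, Matrix.of_apply]
  rw [hs (EuclideanSpace.single k 1) (EuclideanSpace.single j 1),
    hs (EuclideanSpace.single k Complex.I) (EuclideanSpace.single j Complex.I),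
    hs (EuclideanSpace.single k Complex.I) (EuclideanSpace.single j 1),
    hs (EuclideanSpace.single k 1) (EuclideanSpace.single j Complex.I)]
  simp only [Complex.star_def, map_mul, map_add, Complex.conj_ofReal, Complex.conj_I, map_div₀,
    map_one]
  simp only [map_ofNat]
  push_cast
  ring

theorem eq_sum_single {n : ℕ} (x : Cn n) :
    x = ∑ j, ((x j).re • EuclideanSpace.single j (1 : ℂ) +
      (x j).im • EuclideanSpace.single j Complex.I) := by
  ext i
  simp only [WithLp.ofLp_sum, WithLp.ofLp_add, WithLp.ofLp_smul, Finset.sum_apply, Pi.add_apply,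
    Pi.smul_apply, PiLp.single_apply]
  rw [Finset.sum_eq_single i]
  · simp
  · intro j _ hj
    simp [hj.symm]
  · simp

/-- Adding the directions `x` and `i x` cancels all but the `(1,1)`-part of the real Hessian. -/
theorem secondDeriv_add_secondDeriv_I {n : ℕ} (φ : Cn n → ℝ) (z x : Cn n) :
    secondDeriv φ z x x + secondDeriv φ z (Complex.I • x) (Complex.I • x) =
      4 * (∑ j, ∑ k, x j * (starRingEnd ℂ) (x k) * complexHessian φ z j k).re := by
  have expand : ∀ y : Cn n, secondDeriv φ z y y = ∑ j, ∑ k,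
      ((y j).re * (y k).re *
          secondDeriv φ z (EuclideanSpace.single j 1) (EuclideanSpace.single k 1) +
        (y j).re * (y k).im *
          secondDeriv φ z (EuclideanSpace.single j 1) (EuclideanSpace.single k Complex.I) +
        (y j).im * (y k).re *
          secondDeriv φ z (EuclideanSpace.single j Complex.I) (EuclideanSpace.single k 1) +
        (y j).im * (y k).im *
          secondDeriv φ z (EuclideanSpace.single j Complex.I)
            (EuclideanSpace.single k Complex.I)) := by
    intro y
    conv_lhs => rw [eq_sum_single y]
    unfold secondDeriv
    simp only [map_sum, map_add, map_smul, sum_apply,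
      add_apply, smul_apply, smul_eq_mul]
    rw [Finset.sum_comm]
    refine Finset.sum_congr rfl fun j _ => ?_
    rw [Finset.mul_sum, Finset.mul_sum, ← Finset.sum_add_distrib]
    refine Finset.sum_congr rfl fun k _ => ?_
    ring
  rw [expand, expand, ← Finset.sum_add_distrib, Complex.re_sum, Finset.mul_sum]
  refine Finset.sum_congr rfl fun j _ => ?_
  rw [← Finset.sum_add_distrib, Complex.re_sum, Finset.mul_sum]
  refine Finset.sum_congr rfl fun k _ => ?_
  simp [complexHessian]
  ring

open scoped ComplexOrder in
/-- The operator `hessianDensity m H` is a sum of squares of directional derivatives. -/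
theorem exists_hessianDensity_eq_sqLap {n m : ℕ} (hm : 1 ≤ m) (hmn : m ≤ n)
    {H : ℕ → Mat n} (hH : ∀ k, H k ∈ gardingCone n m) :
    ∃ (N : ℕ) (w : Fin N ⊕ Fin N → Cn n), ∀ φ : Cn n → ℝ, ContDiff ℝ 2 φ →
      hessianDensity m H φ = sqLap w φ := by
  set i₀ : Fin n := ⟨0, by omega⟩ with hi₀
  set v : Fin n → Mat n := fun i => if (i : ℕ) < m then H i else 1 with hv
  set T : Mat n →ₗ[ℂ] ℂ := (mixedDiscMulti n).toLinearMap v i₀ with hT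
  have hTA : ∀ A : Mat n, T A = mixedDisc (fun i : Fin n =>
      if (i : ℕ) = 0 then A else if (i : ℕ) < m then H i else 1) := by
    intro A
    rw [hT, MultilinearMap.toLinearMap_apply, mixedDiscMulti_apply]
    congr 1
    funext i
    by_cases hi : (i : ℕ) = 0
    · have : i = i₀ := Fin.ext hi
      subst this
      simp [hi₀]
    · have : i ≠ i₀ := fun h => hi (by rw [h])
      simp [hi, Function.update_of_ne this, hv]
  set G : Mat n := Matrix.of fun k j => T (Matrix.single j k 1) with hG
  have hTG : ∀ A : Mat n, T A = (A * G).trace := by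
    intro A
    conv_lhs => rw [Matrix.matrix_eq_sum_single A]
    simp only [map_sum, Matrix.trace, Matrix.diag_apply, Matrix.mul_apply, hG, Matrix.of_apply]
    refine Finset.sum_congr rfl fun j _ => Finset.sum_congr rfl fun k _ => ?_
    rw [← smul_eq_mul, ← map_smul, Matrix.smul_single, smul_eq_mul, mul_one]
  -- On Hermitian arguments the real part of the functional sees only the Hermitian part of its
  -- trace matrix `G`.
  set P : Mat n := (1 / 2 : ℂ) • (G + G.conjTranspose) with hP
  have hPH : P.IsHermitian := by
    unfold Matrix.IsHermitian
    rw [hP, Matrix.conjTranspose_smul, Matrix.conjTranspose_add, Matrix.conjTranspose_conjTranspose,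
      add_comm]
    simp
  have hTP : ∀ A : Mat n, A.IsHermitian → (T A).re = (A * P).trace.re := by
    intro A hA
    have h1 : (A * G.conjTranspose).trace = (starRingEnd ℂ) (A * G).trace := by
      rw [starRingEnd_apply, ← Matrix.trace_conjTranspose, Matrix.conjTranspose_mul, hA.eq,
        Matrix.trace_mul_comm]
    rw [hTG, hP, Matrix.mul_smul, Matrix.trace_smul, Matrix.mul_add, Matrix.trace_add, h1,
      Complex.add_conj]
    simp
  have hvec : ∀ x : Fin n → ℂ, (Matrix.vecMulVec x (star x) * P).trace = star x ⬝ᵥ P.mulVec x := by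
    intro x
    rw [Matrix.vecMulVec_mul, Matrix.trace_vecMulVec, dotProduct_comm, Matrix.dotProduct_mulVec]
  -- Testing on the rank one matrices `x x*`, which are positive semidefinite, is exactly Gårding's
  -- inequality.
  have hPpos : P.PosSemidef := by
    refine Matrix.PosSemidef.of_dotProduct_mulVec_nonneg hPH fun x => ?_
    rw [Complex.nonneg_iff]
    refine ⟨?_, (hPH.im_star_dotProduct_mulVec_self x).symm⟩
    have hx : (Matrix.vecMulVec x (star x)).PosSemidef := Matrix.posSemidef_vecMulVec_self_star x
    rw [← hvec, ← hTP _ hx.1, hTA]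
    exact garding_inequality hm hmn hx hH
  obtain ⟨N, a, ha⟩ := Matrix.posSemidef_iff_eq_sum_vecMulVec.1 hPpos
  -- Each rank one summand of `P` becomes a pair of directions `x`, `i x`; the factor `1 / 2`
  -- absorbs the `4` of `secondDeriv_add_secondDeriv_I`.
  refine ⟨N, Sum.elim (fun l => WithLp.toLp 2 ((1 / 2 : ℂ) • star (a l)))
    (fun l => Complex.I • WithLp.toLp 2 ((1 / 2 : ℂ) • star (a l))), fun φ hφ => ?_⟩
  funext z
  rw [hessianDensity, ← hTA, hTP _ (complexHessian_isHermitian hφ z), ha, Matrix.mul_sum,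
    Matrix.trace_sum, Complex.re_sum, sqLap, Fintype.sum_sum_type, ← Finset.sum_add_distrib]
  refine Finset.sum_congr rfl fun l _ => ?_
  have := secondDeriv_add_secondDeriv_I φ z (WithLp.toLp 2 ((1 / 2 : ℂ) • star (a l)))
  unfold secondDeriv at this
  simp only [Sum.elim_inl, Sum.elim_inr]
  rw [this, Matrix.mul_vecMulVec, Matrix.trace_vecMulVec, Complex.re_sum, Finset.mul_sum,
    dotProduct, Complex.re_sum]
  refine Finset.sum_congr rfl fun j _ => ?_
  rw [Matrix.mulVec, dotProduct, Finset.sum_mul, Complex.re_sum, Complex.re_sum, Finset.mul_sum]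
  refine Finset.sum_congr rfl fun k _ => ?_
  simp
  ring


/-! ### The cone `SHo` -/

variable {n m : ℕ}

theorem integrable_mul_sqLap {ι : Type*} [Fintype ι] {U : Set (Cn n)} (hU : IsOpen U)
    {u : Cn n → ℝ} (hu : ContinuousOn u U) {φ : Cn n → ℝ} (hφ : ContDiff ℝ ∞ φ)
    (hc : HasCompactSupport φ) (hφU : tsupport φ ⊆ U) (w : ι → Cn n) :
    Integrable (fun z => u z * sqLap w φ z) volume := by
  have hs : ∀ z ∉ tsupport φ, u z * sqLap w φ z = 0 := fun z hz => by
    rw [sqLap_eq_zero w hz, mul_zero]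
  have hts : tsupport (fun z => u z * sqLap w φ z) ⊆ tsupport φ :=
    closure_minimal (fun z hz => by by_contra h; exact hz (hs z h)) (isClosed_tsupport φ)
  refine Continuous.integrable_of_hasCompactSupport ?_
    (HasCompactSupport.intro' hc.isCompact (isClosed_tsupport φ) fun z hz => hs z hz)
  exact ContinuousOn.continuous_of_tsupport_subset
    (hu.mul (continuous_sqLap (contDiff_infty.1 hφ 2) w).continuousOn) hU (hts.trans hφU)

theorem IsSubharmonicOn.of_continuousOn {U : Set (Cn n)} (hU : IsOpen U) {u : Cn n → ℝ}
    (hu : ContinuousOn u U) (h : ∀ (a : Cn n) (r : ℝ), 0 < r → Metric.closedBall a r ⊆ U →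
      u a ≤ ⨍ z in Metric.closedBall a r, u z ∂volume) : IsSubharmonicOn u U where
  usc := hu.upperSemicontinuousOn
  locInt := hu.locallyIntegrableOn hU.measurableSet
  submean := h

theorem integrableOn_closedBall {U : Set (Cn n)} {u : Cn n → ℝ} (hu : ContinuousOn u U) {a : Cn n}
    {r : ℝ} (h : Metric.closedBall a r ⊆ U) : IntegrableOn u (Metric.closedBall a r) volume :=
  (hu.mono h).integrableOn_compact (isCompact_closedBall a r)

theorem setAverage_mono_ball {U : Set (Cn n)} {u v : Cn n → ℝ} (hu : ContinuousOn u U)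
    (hv : ContinuousOn v U) (huv : ∀ z, u z ≤ v z) {a : Cn n} {r : ℝ}
    (h : Metric.closedBall a r ⊆ U) :
    ⨍ z in Metric.closedBall a r, u z ∂volume ≤ ⨍ z in Metric.closedBall a r, v z ∂volume := by
  rw [setAverage_eq, setAverage_eq]
  exact smul_le_smul_of_nonneg_left (setIntegral_mono (integrableOn_closedBall hu h)
    (integrableOn_closedBall hv h) huv) (by positivity)

theorem IsMSubharmonicOn.mono {U V : Set (Cn n)} {u : Cn n → ℝ} (h : IsMSubharmonicOn m u U)
    (hVU : V ⊆ U) : IsMSubharmonicOn m u V where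
  subharmonic :=
    { usc := h.subharmonic.usc.mono hVU
      locInt := h.subharmonic.locInt.mono_set hVU
      submean := fun a r hr hB => h.subharmonic.submean a r hr (hB.trans hVU) }
  current_nonneg H hH φ h1 h2 h3 h4 := h.current_nonneg H hH φ h1 h2 (h3.trans hVU) h4

theorem isMSubharmonicOn_const (hm : 1 ≤ m) (hmn : m ≤ n) {U : Set (Cn n)} (hU : IsOpen U)
    (c : ℝ) : IsMSubharmonicOn m (fun _ => c) U where
  subharmonic := IsSubharmonicOn.of_continuousOn hU continuousOn_const fun a r hr _ => by
    rw [setAverage_const (Metric.measure_closedBall_pos volume a hr).ne'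
      measure_closedBall_lt_top.ne]
  current_nonneg H hH φ h1 h2 _ _ := by
    obtain ⟨N, w, hw⟩ := exists_hessianDensity_eq_sqLap hm hmn hH
    rw [hw φ (contDiff_infty.1 h1 2), integral_const_mul,
      integral_sqLap volume (contDiff_infty.1 h1 2) h2, mul_zero]

theorem IsMSubharmonicOn.add (hm : 1 ≤ m) (hmn : m ≤ n) {U : Set (Cn n)} (hU : IsOpen U)
    {u v : Cn n → ℝ} (hu : ContinuousOn u U) (hv : ContinuousOn v U)
    (h : IsMSubharmonicOn m u U) (h' : IsMSubharmonicOn m v U) :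
    IsMSubharmonicOn m (fun z => u z + v z) U where
  subharmonic := IsSubharmonicOn.of_continuousOn hU (hu.add hv) fun a r hr hB => by
    have h1 := h.subharmonic.submean a r hr hB
    have h2 := h'.subharmonic.submean a r hr hB
    rw [setAverage_eq] at h1 h2 ⊢
    rw [integral_add (integrableOn_closedBall hu hB) (integrableOn_closedBall hv hB), smul_add]
    exact add_le_add h1 h2
  current_nonneg H hH φ h1 h2 h3 h4 := by
    have e1 := h.current_nonneg H hH φ h1 h2 h3 h4
    have e2 := h'.current_nonneg H hH φ h1 h2 h3 h4
    obtain ⟨N, w, hw⟩ := exists_hessianDensity_eq_sqLap hm hmn hH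
    rw [hw φ (contDiff_infty.1 h1 2)] at e1 e2 ⊢
    simp only [add_mul]
    rw [integral_add (integrable_mul_sqLap hU hu h1 h2 h3 w)
      (integrable_mul_sqLap hU hv h1 h2 h3 w)]
    exact add_nonneg e1 e2

theorem IsMSubharmonicOn.const_mul {U : Set (Cn n)} (hU : IsOpen U) {u : Cn n → ℝ}
    (hu : ContinuousOn u U) (h : IsMSubharmonicOn m u U) {c : ℝ} (hc : 0 ≤ c) :
    IsMSubharmonicOn m (fun z => c * u z) U where
  subharmonic := IsSubharmonicOn.of_continuousOn hU (continuousOn_const.mul hu)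
    fun a r hr hB => by
      have h1 := mul_le_mul_of_nonneg_left (h.subharmonic.submean a r hr hB) hc
      rw [setAverage_eq, smul_eq_mul] at h1 ⊢
      rw [integral_const_mul]
      linarith
  current_nonneg H hH φ h1 h2 h3 h4 := by
    have := mul_nonneg hc (h.current_nonneg H hH φ h1 h2 h3 h4)
    rw [← integral_const_mul] at this
    simpa only [mul_assoc] using this

/-- The directions `w` depend only on `H`, so both functions satisfy the same weak inequality and
`WeakNonneg.sup` applies. -/
theorem IsMSubharmonicOn.sup (hm : 1 ≤ m) (hmn : m ≤ n) {U : Set (Cn n)} (hU : IsOpen U)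
    {u v : Cn n → ℝ} (hu : ContinuousOn u U) (hv : ContinuousOn v U)
    (h : IsMSubharmonicOn m u U) (h' : IsMSubharmonicOn m v U) :
    IsMSubharmonicOn m (fun z => max (u z) (v z)) U where
  subharmonic := IsSubharmonicOn.of_continuousOn hU (hu.sup hv) fun a r hr hB =>
    max_le ((h.subharmonic.submean a r hr hB).trans
        (setAverage_mono_ball hu (hu.sup hv) (fun _ => le_max_left _ _) hB))
      ((h'.subharmonic.submean a r hr hB).trans
        (setAverage_mono_ball hv (hu.sup hv) (fun _ => le_max_right _ _) hB))
  current_nonneg H hH φ h1 h2 h3 h4 := by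
    obtain ⟨N, w, hw⟩ := exists_hessianDensity_eq_sqLap hm hmn hH
    have key : ∀ f : Cn n → ℝ, IsMSubharmonicOn m f U → WeakNonneg volume w f U := by
      intro f hf ψ k1 k2 k3 k4
      rw [← hw ψ (contDiff_infty.1 k1 2)]
      exact hf.current_nonneg H hH ψ k1 k2 k3 k4
    rw [hw φ (contDiff_infty.1 h1 2)]
    exact (key u h).sup volume hU (key v h') hu hv φ h1 h2 h3 h4

variable {X : Set (Cn n)}

theorem continuous_of_mem_SHo {f : X → ℝ} (hf : f ∈ SHo m X) : Continuous f := by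
  obtain ⟨U, v, hU, hXU, hv, -, h⟩ := hf
  have : f = fun x : X => v x := funext h
  rw [this]
  exact (hv.mono hXU).domRestrict

theorem const_mem_SHo (hm : 1 ≤ m) (hmn : m ≤ n) (c : ℝ) : (fun _ : X => c) ∈ SHo m X :=
  ⟨Set.univ, fun _ => c, isOpen_univ, Set.subset_univ _, continuousOn_const,
    isMSubharmonicOn_const hm hmn isOpen_univ c, fun _ => rfl⟩

theorem add_mem_SHo (hm : 1 ≤ m) (hmn : m ≤ n) {f g : X → ℝ} (hf : f ∈ SHo m X)
    (hg : g ∈ SHo m X) : (fun x => f x + g x) ∈ SHo m X := by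
  obtain ⟨U, u, hU, hXU, hu, hu', hfu⟩ := hf
  obtain ⟨V, v, hV, hXV, hv, hv', hgv⟩ := hg
  refine ⟨U ∩ V, fun z => u z + v z, hU.inter hV, Set.subset_inter hXU hXV, ?_, ?_, fun x => ?_⟩
  · exact (hu.mono Set.inter_subset_left).add (hv.mono Set.inter_subset_right)
  · exact (hu'.mono Set.inter_subset_left).add hm hmn (hU.inter hV)
      (hu.mono Set.inter_subset_left) (hv.mono Set.inter_subset_right)
      (hv'.mono Set.inter_subset_right)
  · simp only [hfu, hgv]

theorem sup_mem_SHo (hm : 1 ≤ m) (hmn : m ≤ n) {f g : X → ℝ} (hf : f ∈ SHo m X)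
    (hg : g ∈ SHo m X) : (fun x => max (f x) (g x)) ∈ SHo m X := by
  obtain ⟨U, u, hU, hXU, hu, hu', hfu⟩ := hf
  obtain ⟨V, v, hV, hXV, hv, hv', hgv⟩ := hg
  refine ⟨U ∩ V, fun z => max (u z) (v z), hU.inter hV, Set.subset_inter hXU hXV, ?_, ?_,
    fun x => ?_⟩
  · exact (hu.mono Set.inter_subset_left).sup (hv.mono Set.inter_subset_right)
  · exact (hu'.mono Set.inter_subset_left).sup hm hmn (hU.inter hV)
      (hu.mono Set.inter_subset_left) (hv.mono Set.inter_subset_right)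
      (hv'.mono Set.inter_subset_right)
  · simp only [hfu, hgv]

theorem const_mul_mem_SHo {f : X → ℝ} (hf : f ∈ SHo m X) {c : ℝ} (hc : 0 ≤ c) :
    (fun x => c * f x) ∈ SHo m X := by
  obtain ⟨U, u, hU, hXU, hu, hu', hfu⟩ := hf
  exact ⟨U, fun z => c * u z, hU, hXU, continuousOn_const.mul hu, hu'.const_mul hU hu hc,
    fun x => by simp only [hfu]⟩


/-! ### Jensen measures and Edwards' duality -/

/-- The competitors in the definition of `edwardsGauge`. -/
def edwardsSet (m : ℕ) (z : X) (f : C(X, ℝ)) : Set ℝ :=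
  {r | ∃ v ∈ SHo m X, (∀ x, v x ≤ -f x) ∧ r = -v z}

/-- The sublinear functional `f ↦ inf {-v z | v ∈ SHo, v ≤ -f}`. -/
def edwardsGauge (m : ℕ) (z : X) (f : C(X, ℝ)) : ℝ := sInf (edwardsSet m z f)

theorem bddBelow_edwardsSet (z : X) (f : C(X, ℝ)) : BddBelow (edwardsSet m z f) :=
  ⟨f z, by rintro r ⟨v, -, hv, rfl⟩; linarith [hv z]⟩

theorem edwardsGauge_le {z : X} {f : C(X, ℝ)} {v : X → ℝ} (hv : v ∈ SHo m X)
    (hvf : ∀ x, v x ≤ -f x) : edwardsGauge m z f ≤ -v z :=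
  csInf_le (bddBelow_edwardsSet z f) ⟨v, hv, hvf, rfl⟩

theorem edwardsSet_nonempty [CompactSpace X] (hm : 1 ≤ m) (hmn : m ≤ n) (z : X) (f : C(X, ℝ)) :
    (edwardsSet m z f).Nonempty :=
  ⟨_, fun _ => -‖f‖, const_mem_SHo hm hmn _,
    fun x => neg_le_neg ((le_abs_self _).trans (f.norm_coe_le_norm x)), rfl⟩

theorem edwardsGauge_add_le [CompactSpace X] (hm : 1 ≤ m) (hmn : m ≤ n) (z : X) (f g : C(X, ℝ)) :
    edwardsGauge m z (f + g) ≤ edwardsGauge m z f + edwardsGauge m z g := by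
  have h1 : ∀ r ∈ edwardsSet m z f, ∀ s ∈ edwardsSet m z g, edwardsGauge m z (f + g) ≤ r + s := by
    rintro r ⟨v, hv, hvf, rfl⟩ s ⟨v', hv', hvg, rfl⟩
    refine (edwardsGauge_le (add_mem_SHo hm hmn hv hv') fun x => ?_).trans_eq (neg_add _ _)
    rw [ContinuousMap.add_apply, neg_add]
    exact add_le_add (hvf x) (hvg x)
  rw [← sub_le_iff_le_add']
  refine le_csInf (edwardsSet_nonempty hm hmn z g) fun s hs => ?_
  rw [sub_le_iff_le_add', ← sub_le_iff_le_add]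
  exact le_csInf (edwardsSet_nonempty hm hmn z f) fun r hr =>
    sub_le_iff_le_add.2 (h1 r hr s hs)

theorem edwardsGauge_smul_le [CompactSpace X] (hm : 1 ≤ m) (hmn : m ≤ n) (z : X) {c : ℝ}
    (hc : 0 < c) (f : C(X, ℝ)) : edwardsGauge m z (c • f) ≤ c * edwardsGauge m z f := by
  rw [mul_comm, ← div_le_iff₀ hc]
  refine le_csInf (edwardsSet_nonempty hm hmn z f) ?_
  rintro r ⟨v, hv, hvf, rfl⟩
  rw [div_le_iff₀ hc]
  refine (edwardsGauge_le (const_mul_mem_SHo hv hc.le) fun x => ?_).trans_eq (by ring)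
  rw [ContinuousMap.smul_apply, smul_eq_mul, ← mul_neg]
  exact mul_le_mul_of_nonneg_left (hvf x) hc.le

theorem edwardsGauge_smul [CompactSpace X] (hm : 1 ≤ m) (hmn : m ≤ n) (z : X) (c : ℝ)
    (hc : 0 < c) (f : C(X, ℝ)) : edwardsGauge m z (c • f) = c * edwardsGauge m z f := by
  refine le_antisymm (edwardsGauge_smul_le hm hmn z hc f) ?_
  have := edwardsGauge_smul_le hm hmn z (inv_pos.2 hc) (c • f)
  rw [smul_smul, inv_mul_cancel₀ hc.ne', one_smul] at this
  rwa [← le_inv_mul_iff₀ hc]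

/-- Linear functionals dominated by `edwardsGauge` are Jensen measures. -/
theorem exists_jensenMeasure_of_le_edwardsGauge [CompactSpace X] (hm : 1 ≤ m) (hmn : m ≤ n)
    (z : X) (g : C(X, ℝ) →ₗ[ℝ] ℝ) (hg : ∀ f, g f ≤ edwardsGauge m z f) :
    ∃ μ ∈ jensenMeasures m X z, ∀ f : C(X, ℝ), ∫ x, f x ∂μ = g f := by
  have hpos : ∀ f : C(X, ℝ), 0 ≤ f → 0 ≤ g f := fun f hf => by
    have h1 := (hg (-f)).trans (edwardsGauge_le (const_mem_SHo hm hmn 0) fun x => by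
      rw [ContinuousMap.neg_apply, neg_neg]; exact hf x)
    rw [map_neg] at h1
    linarith
  let Λ₀ : CompactlySupportedContinuousMap X ℝ →ₗ[ℝ] ℝ :=
    { toFun := fun f => g f.toContinuousMap
      map_add' := fun f f' => g.map_add f.toContinuousMap f'.toContinuousMap
      map_smul' := fun c f => g.map_smul c f.toContinuousMap }
  let Λ : CompactlySupportedContinuousMap X ℝ →ₚ[ℝ] ℝ :=
    PositiveLinearMap.mk₀ Λ₀ fun f hf => hpos f.toContinuousMap fun x => hf x
  have hint : ∀ f : C(X, ℝ), ∫ x, f x ∂(RealRMK.rieszMeasure Λ) = g f := fun f =>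
    RealRMK.integral_rieszMeasure Λ ⟨f, HasCompactSupport.of_compactSpace f⟩
  refine ⟨RealRMK.rieszMeasure Λ, ⟨?_, inferInstance, fun v hv => ?_⟩, hint⟩
  -- The constants `-1` and `1` as competitors bound the total mass by `1` from above and below.
  · have h1 := (hg 1).trans (edwardsGauge_le (const_mem_SHo hm hmn (-1)) fun x => le_rfl)
    have h2 := (hg (-1)).trans (edwardsGauge_le (const_mem_SHo hm hmn 1) fun x => by simp)
    rw [map_neg] at h2
    have h3 := hint 1
    simp only [ContinuousMap.one_apply, integral_const, smul_eq_mul, mul_one] at h3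
    rw [isProbabilityMeasure_iff_real, h3]
    linarith
  -- For `-v` the function `v` is itself a competitor, which gives the Jensen inequality.
  · have h1 := hint ⟨v, continuous_of_mem_SHo hv⟩
    have h2 := (hg (-⟨v, continuous_of_mem_SHo hv⟩)).trans (edwardsGauge_le hv fun x => by simp)
    rw [map_neg] at h2
    simp only [ContinuousMap.coe_mk] at h1
    linarith

/-- **Edwards' theorem**: if every minorant of `φ` in `SHo` is at most `a` at `z`, then some Jensen
measure for `z` gives `φ` an integral of at most `a`. -/
theorem exists_jensenMeasure_integral_le [CompactSpace X] (hm : 1 ≤ m) (hmn : m ≤ n)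
    (z : X) (φ : C(X, ℝ)) {a : ℝ} (ha : ∀ v ∈ SHo m X, (∀ x, v x ≤ φ x) → v z ≤ a) :
    ∃ μ ∈ jensenMeasures m X z, ∫ x, φ x ∂μ ≤ a := by
  set N := edwardsGauge m z with hN
  have hsmul : ∀ c : ℝ, 0 < c → ∀ f, N (c • f) = c * N f := edwardsGauge_smul hm hmn z
  have hadd : ∀ f g, N (f + g) ≤ N f + N g := edwardsGauge_add_le hm hmn z
  have hN0 : N 0 = 0 := by
    have := hsmul 2 two_pos 0
    rw [smul_zero] at this
    linarith
  have hNneg : 0 ≤ N φ + N (-φ) := by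
    have := hadd φ (-φ)
    rw [add_neg_cancel] at this
    linarith
  have hspan : ∀ c : ℝ, c • φ = 0 → RingHom.id ℝ c • (-N (-φ)) = 0 := fun c hc => by
    rcases smul_eq_zero.1 hc with h | h
    · simp [h]
    · simp [h, hN0]
  -- Hahn–Banach from the line through `φ`, where `φ` receives `-N (-φ)`, the least value allowed by
  -- domination: it is the supremum at `z` of the minorants of `φ`.
  obtain ⟨g, hg1, hg2⟩ := exists_extension_of_le_sublinear
    (LinearPMap.mkSpanSingleton' φ (-N (-φ)) hspan) N hsmul hadd (by
      rintro ⟨x, hx⟩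
      obtain ⟨t, rfl⟩ := Submodule.mem_span_singleton.1 hx
      rw [LinearPMap.mkSpanSingleton'_apply, RingHom.id_apply, smul_eq_mul]
      change t * -N (-φ) ≤ N (t • φ)
      rcases lt_trichotomy t 0 with h | h | h
      · have := hsmul (-t) (by linarith) (-φ)
        rw [smul_neg, neg_smul, neg_neg] at this
        rw [this]
        linarith
      · simp [h, hN0]
      · rw [hsmul t h]
        exact mul_le_mul_of_nonneg_left (by linarith) h.le)
  obtain ⟨μ, hμ, hint⟩ := exists_jensenMeasure_of_le_edwardsGauge hm hmn z g hg2
  refine ⟨μ, hμ, ?_⟩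
  have h1 : g φ = -N (-φ) := (hg1 ⟨φ, Submodule.mem_span_singleton_self φ⟩).trans
    (LinearPMap.mkSpanSingleton'_apply_self φ _ hspan _)
  rw [hint, h1, neg_le]
  refine le_csInf (edwardsSet_nonempty hm hmn z _) ?_
  rintro r ⟨v, hv, hvf, rfl⟩
  exact neg_le_neg (ha v hv fun x => by simpa using hvf x)

/-! ### The extended integral -/

section ExtIntegral

variable {α : Type*} [MeasurableSpace α] {μ : Measure α}

theorem extIntegral_mono {u v : α → EReal} (h : ∀ x, u x ≤ v x) :
    extIntegral u μ ≤ extIntegral v μ := by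
  refine EReal.sub_le_sub ?_ ?_
  · exact EReal.coe_ennreal_le_coe_ennreal_iff.2
      (lintegral_mono fun x => EReal.toENNReal_le_toENNReal (h x))
  · exact EReal.coe_ennreal_le_coe_ennreal_iff.2
      (lintegral_mono fun x => EReal.toENNReal_le_toENNReal (EReal.neg_le_neg_iff.2 (h x)))

theorem extIntegral_coe {f : α → ℝ} (hf : Integrable f μ) :
    extIntegral (fun x => (f x : EReal)) μ = ((∫ x, f x ∂μ : ℝ) : EReal) := by
  unfold extIntegral
  simp only [← EReal.coe_neg, EReal.real_coe_toENNReal]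
  rw [integral_eq_lintegral_pos_part_sub_lintegral_neg_part hf]
  have h1 : ∫⁻ x, ENNReal.ofReal (f x) ∂μ ≠ ⊤ := hf.lintegral_lt_top.ne
  have h2 : ∫⁻ x, ENNReal.ofReal (-f x) ∂μ ≠ ⊤ := hf.neg.lintegral_lt_top.ne
  lift ∫⁻ x, ENNReal.ofReal (f x) ∂μ to NNReal using h1 with a
  lift ∫⁻ x, ENNReal.ofReal (-f x) ∂μ to NNReal using h2 with b
  rw [EReal.coe_sub]
  rfl

/-- Positive parts decrease from an integrable function and negative parts increase, so both
integrals converge. The positive limit is finite, hence the subtraction is continuous there even if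
the result is `-∞`. -/
theorem le_extIntegral_of_antitone [IsFiniteMeasure μ] {f : ℕ → α → ℝ} {u : α → EReal} {a : EReal}
    (hfi : ∀ j, Integrable (f j) μ) (hf : DecreasesTo f u)
    (ha : ∀ j, a ≤ ((∫ x, f j x ∂μ : ℝ) : EReal)) : a ≤ extIntegral u μ := by
  have hpos : Tendsto (fun j => ∫⁻ x, ENNReal.ofReal (f j x) ∂μ) atTop
      (𝓝 (∫⁻ x, (u x).toENNReal ∂μ)) := by
    refine lintegral_tendsto_of_tendsto_of_antitone (fun j => (hfi j).aemeasurable.ennreal_ofReal)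
      (ae_of_all _ fun x i j hij => ENNReal.ofReal_le_ofReal ((hf x).1 hij))
      (hfi 0).lintegral_lt_top.ne (ae_of_all _ fun x => ?_)
    have := (EReal.continuous_toENNReal.tendsto (u x)).comp (hf x).2
    simpa [Function.comp_def] using this
  have hneg : Tendsto (fun j => ∫⁻ x, ENNReal.ofReal (-f j x) ∂μ) atTop
      (𝓝 (∫⁻ x, (-u x).toENNReal ∂μ)) := by
    refine lintegral_tendsto_of_tendsto_of_monotone
      (fun j => (hfi j).neg.aemeasurable.ennreal_ofReal)
      (ae_of_all _ fun x i j hij => ENNReal.ofReal_le_ofReal (neg_le_neg ((hf x).1 hij)))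
      (ae_of_all _ fun x => ?_)
    have := (EReal.continuous_toENNReal.tendsto (-u x)).comp
      ((continuous_neg.tendsto (u x)).comp (hf x).2)
    simpa [Function.comp_def, ← EReal.coe_neg] using this
  have hfin : ∫⁻ x, (u x).toENNReal ∂μ ≠ ⊤ := by
    refine ((lintegral_mono fun x => ?_).trans_lt (hfi 0).lintegral_lt_top).ne
    rw [← EReal.real_coe_toENNReal]
    refine EReal.toENNReal_le_toENNReal (le_of_tendsto (hf x).2 ?_)
    filter_upwards with j
    exact EReal.coe_le_coe_iff.2 ((hf x).1 (Nat.zero_le j))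
  have hlim : Tendsto (fun j => extIntegral (fun x => (f j x : EReal)) μ) atTop
      (𝓝 (extIntegral u μ)) := by
    unfold extIntegral
    simp only [← EReal.coe_neg, EReal.real_coe_toENNReal, sub_eq_add_neg]
    refine (EReal.continuousAt_add (p := (_, _)) ?_ ?_).tendsto.comp
      (((continuous_coe_ennreal_ereal.tendsto _).comp hpos).prodMk_nhds
        ((continuous_neg.tendsto _).comp
          ((continuous_coe_ennreal_ereal.tendsto _).comp hneg)))
    · exact Or.inl (by simpa using hfin)
    · exact Or.inl (EReal.coe_ennreal_ne_bot _)
  refine ge_of_tendsto' hlim fun j => ?_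
  rw [extIntegral_coe (hfi j)]
  exact ha j

end ExtIntegral


/-! ### Approximation -/

theorem extIntegral_coe_of_continuous [CompactSpace X] {z : X} {μ : Measure X}
    (hμ : μ ∈ jensenMeasures m X z) {f : X → ℝ} (hf : Continuous f) :
    extIntegral (fun x => (f x : EReal)) μ = ((∫ x, f x ∂μ : ℝ) : EReal) :=
  have := hμ.1
  extIntegral_coe (hf.integrable_of_hasCompactSupport (HasCompactSupport.of_compactSpace f))

/-- A strict continuous majorant of an upper semicontinuous function leaves uniform room. -/
theorem exists_pos_lt_sub [CompactSpace X] {u : X → EReal} (hu : UpperSemicontinuous u)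
    {φ : X → ℝ} (hφ : Continuous φ) (huφ : ∀ x, u x < φ x) :
    ∃ ε : ℝ, 0 < ε ∧ ∀ x, u x < ((φ x - ε : ℝ) : EReal) := by
  have := isCompact_univ.induction_on
    (p := fun s : Set X => ∃ ε : ℝ, 0 < ε ∧ ∀ x ∈ s, u x < ((φ x - ε : ℝ) : EReal))
    ⟨1, one_pos, by simp⟩ (fun s t hst ⟨ε, h0, h⟩ => ⟨ε, h0, fun x hx => h x (hst hx)⟩)
    (fun s t ⟨ε, h0, h⟩ ⟨ε', h0', h'⟩ => ⟨min ε ε', lt_min h0 h0', fun x hx => by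
      rcases hx with hx | hx
      · exact (h x hx).trans_le
          (EReal.coe_le_coe_iff.2 (sub_le_sub_left (min_le_left _ _) _))
      · exact (h' x hx).trans_le
          (EReal.coe_le_coe_iff.2 (sub_le_sub_left (min_le_right _ _) _))⟩)
    (fun x _ => by
      obtain ⟨c, hc1, hc2⟩ := EReal.lt_iff_exists_real_btwn.1 (huφ x)
      have hc2 : c < φ x := EReal.coe_lt_coe_iff.1 hc2
      refine ⟨{y | u y < c ∧ c < φ y - (φ x - c) / 2}, ?_, (φ x - c) / 2, by linarith,
        fun y hy => hy.1.trans (EReal.coe_lt_coe_iff.2 hy.2)⟩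
      refine mem_nhdsWithin_of_mem_nhds ((hu x c hc1).and ?_)
      exact (hφ.sub continuous_const).continuousAt.eventually_const_lt
        (show c < φ x - (φ x - c) / 2 by linarith))
  obtain ⟨ε, h0, h⟩ := this
  exact ⟨ε, h0, fun x => h x (Set.mem_univ x)⟩

/-- Between a function in `SH` and a strict continuous majorant there is a function in `SHo`. -/
theorem exists_mem_SHo_between [CompactSpace X] (hm : 1 ≤ m) (hmn : m ≤ n) {u : X → EReal}
    (hu : u ∈ SH m X) {φ : X → ℝ} (hφ : Continuous φ) (huφ : ∀ x, u x < φ x) :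
    ∃ v ∈ SHo m X, (∀ x, v x ≤ φ x) ∧ ∀ x, u x < v x := by
  obtain ⟨⟨husc, hutop⟩, hJ⟩ := hu
  obtain ⟨ε, hε, hεu⟩ := exists_pos_lt_sub husc hφ huφ
  obtain ⟨v₀, hv₀, hv₀φ⟩ : ∃ v₀ ∈ SHo m X, ∀ x, v₀ x ≤ φ x :=
    ⟨fun _ => -‖(⟨φ, hφ⟩ : C(X, ℝ))‖, const_mem_SHo hm hmn _, fun x =>
      (abs_le.1 ((⟨φ, hφ⟩ : C(X, ℝ)).norm_coe_le_norm x)).1⟩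
  -- Otherwise duality gives a Jensen measure with `∫ φ ≤ u z`, while `u z ≤ ∫ φ - ε`. The value
  -- `-∞` is treated apart, with `v₀`.
  have hpt : ∀ z : X, ∃ v ∈ SHo m X, (∀ x, v x ≤ φ x) ∧ u z < v z := by
    intro z
    by_contra! hno
    have hbot : u z ≠ ⊥ := fun h => by
      have := hno v₀ hv₀ hv₀φ
      rw [h] at this
      exact EReal.coe_ne_bot _ (le_bot_iff.1 this)
    lift u z to ℝ using ⟨hutop z, hbot⟩ with a ha
    obtain ⟨μ, hμ, hle⟩ := exists_jensenMeasure_integral_le hm hmn z ⟨φ, hφ⟩ (a := a)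
      fun v hv hvφ => EReal.coe_le_coe_iff.1 (hno v hv hvφ)
    have h1 := (hJ z μ hμ).trans (extIntegral_mono fun x => (hεu x).le)
    rw [extIntegral_coe_of_continuous (f := fun x => φ x - ε) hμ (hφ.sub continuous_const), ← ha,
      EReal.coe_le_coe_iff] at h1
    have := hμ.1
    rw [integral_sub (hφ.integrable_of_hasCompactSupport (HasCompactSupport.of_compactSpace φ))
      (integrable_const _)] at h1
    simp only [integral_const, probReal_univ, one_smul, ContinuousMap.coe_mk] at h1 hle
    linarith
  obtain ⟨v, hv, hvφ, huv⟩ := isCompact_univ.induction_on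
    (p := fun s : Set X => ∃ v ∈ SHo m X, (∀ x, v x ≤ φ x) ∧ ∀ x ∈ s, u x < v x)
    ⟨v₀, hv₀, hv₀φ, by simp⟩
    (fun s t hst ⟨v, hv, hvφ, h⟩ => ⟨v, hv, hvφ, fun x hx => h x (hst hx)⟩)
    (fun s t ⟨v, hv, hvφ, h⟩ ⟨v', hv', hvφ', h'⟩ => ⟨fun x => max (v x) (v' x),
      sup_mem_SHo hm hmn hv hv', fun x => max_le (hvφ x) (hvφ' x), fun x hx => by
        rcases hx with hx | hx
        · exact (h x hx).trans_le (EReal.coe_le_coe_iff.2 (le_max_left _ _))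
        · exact (h' x hx).trans_le (EReal.coe_le_coe_iff.2 (le_max_right _ _))⟩)
    (fun z _ => by
      obtain ⟨v, hv, hvφ, huv⟩ := hpt z
      obtain ⟨c, hc1, hc2⟩ := EReal.lt_iff_exists_real_btwn.1 huv
      have hc2 : c < v z := EReal.coe_lt_coe_iff.1 hc2
      refine ⟨{y | u y < c ∧ c < v y}, mem_nhdsWithin_of_mem_nhds ((husc z c hc1).and
        ((continuous_of_mem_SHo hv).continuousAt.eventually_const_lt hc2)), v, hv, hvφ,
        fun y hy => hy.1.trans (EReal.coe_lt_coe_iff.2 hy.2)⟩)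
  exact ⟨v, hv, hvφ, fun x => huv x (Set.mem_univ x)⟩

theorem exists_real_gt_of_usc [CompactSpace X] {u : X → EReal} (hu : u ∈ USC X) :
    ∃ M : ℝ, ∀ x, u x < M := by
  obtain ⟨M, hM⟩ := isCompact_univ.induction_on
    (p := fun s : Set X => ∃ M : ℝ, ∀ x ∈ s, u x < M) ⟨0, by simp⟩
    (fun s t hst ⟨M, h⟩ => ⟨M, fun x hx => h x (hst hx)⟩)
    (fun s t ⟨M, h⟩ ⟨M', h'⟩ => ⟨max M M', fun x hx => by
      rcases hx with hx | hx
      · exact (h x hx).trans_le (EReal.coe_le_coe_iff.2 (le_max_left _ _))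
      · exact (h' x hx).trans_le (EReal.coe_le_coe_iff.2 (le_max_right _ _))⟩)
    (fun x _ => by
      obtain ⟨c, hc1, -⟩ := EReal.lt_iff_exists_real_btwn.1 (lt_top_iff_ne_top.2 (hu.2 x))
      exact ⟨{y | u y < c}, mem_nhdsWithin_of_mem_nhds (hu.1 x c hc1), c, fun y hy => hy⟩)
  exact ⟨M, fun x => hM x (Set.mem_univ x)⟩

/-- A cone over `x₀`: its vertex value already dominates `u` within distance `δ`, and its slope
brings it above the global bound `M` beyond. -/
theorem exists_continuous_gt_of_usc [CompactSpace X] {u : X → EReal} (hu : u ∈ USC X) {x₀ : X}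
    {c : ℝ} (hc : u x₀ < c) : ∃ φ : X → ℝ, Continuous φ ∧ (∀ x, u x < φ x) ∧ φ x₀ < c := by
  obtain ⟨M, hM⟩ := exists_real_gt_of_usc hu
  obtain ⟨c', hc1, hc2⟩ := EReal.lt_iff_exists_real_btwn.1 hc
  obtain ⟨δ, hδ, hball⟩ := Metric.eventually_nhds_iff.1 (hu.1 x₀ c' hc1)
  refine ⟨fun y => c' + |M - c'| / δ * dist y x₀, by fun_prop, fun y => ?_, ?_⟩
  · rcases lt_or_ge (dist y x₀) δ with h | h
    · refine (hball h).trans_le (EReal.coe_le_coe_iff.2 ?_)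
      have : 0 ≤ |M - c'| / δ * dist y x₀ := by positivity
      linarith
    · refine (hM y).trans_le (EReal.coe_le_coe_iff.2 ?_)
      have h1 : |M - c'| / δ * δ ≤ |M - c'| / δ * dist y x₀ :=
        mul_le_mul_of_nonneg_left h (by positivity)
      rw [div_mul_cancel₀ _ hδ.ne'] at h1
      linarith [le_abs_self (M - c')]
  · simpa using EReal.coe_lt_coe_iff.1 hc2

/-- The strict majorants of `u` in `SHo` have infimum `u`, and the sandwich applied below the
minimum of two of them shows that they are directed downwards. Lindelöf reduces to countably many.
-/
theorem exists_decreasing_of_mem_SH [CompactSpace X] (hm : 1 ≤ m) (hmn : m ≤ n) {u : X → EReal}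
    (hu : u ∈ SH m X) : ∃ f : ℕ → X → ℝ, (∀ j, f j ∈ SHo m X) ∧ DecreasesTo f u := by
  let I := {v : X → ℝ // v ∈ SHo m X ∧ ∀ x, u x < v x}
  obtain ⟨M, hM⟩ := exists_real_gt_of_usc hu.1
  obtain ⟨v₀, hv₀, -, huv₀⟩ := exists_mem_SHo_between hm hmn hu
    (φ := fun _ => M) continuous_const hM
  -- A countable subfamily whose open strict epigraphs have the same union has the same pointwise
  -- infimum.
  let s : I → Set (X × ℝ) := fun v => {p | v.1 p.1 < p.2}
  have hs : ∀ v, IsOpen (s v) := fun v =>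
    isOpen_lt ((continuous_of_mem_SHo v.2.1).comp continuous_fst) continuous_snd
  obtain ⟨T, hTc, hT⟩ := TopologicalSpace.isOpen_iUnion_countable s hs
  obtain ⟨g, hg⟩ := (hTc.insert ⟨v₀, hv₀, huv₀⟩).exists_eq_range (Set.insert_nonempty _ _)
  have hstep : ∀ (k : ℕ) (f : I), ∃ f' : I, ∀ x, f'.1 x ≤ min (f.1 x) ((g k).1 x) := by
    intro k f
    obtain ⟨v, hv, hvφ, huv⟩ := exists_mem_SHo_between hm hmn hu
      ((continuous_of_mem_SHo f.2.1).min (continuous_of_mem_SHo (g k).2.1)) fun x => by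
        rcases min_choice (f.1 x) ((g k).1 x) with h | h
        · rw [h]; exact f.2.2 x
        · rw [h]; exact (g k).2.2 x
    exact ⟨⟨v, hv, huv⟩, hvφ⟩
  choose next hnext using hstep
  let F : ℕ → I := fun k => Nat.rec (next 0 ⟨v₀, hv₀, huv₀⟩) (fun k f => next (k + 1) f) k
  have hF1 : ∀ k x, (F (k + 1)).1 x ≤ (F k).1 x := fun k x =>
    (hnext (k + 1) (F k) x).trans (min_le_left _ _)
  have hF2 : ∀ k x, (F k).1 x ≤ (g k).1 x := fun k x => by
    cases k with
    | zero => exact (hnext 0 _ x).trans (min_le_right _ _)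
    | succ k => exact (hnext (k + 1) (F k) x).trans (min_le_right _ _)
  refine ⟨fun k => (F k).1, fun k => (F k).2.1, fun x => ?_⟩
  have hanti : Antitone fun k => (F k).1 x := antitone_nat_of_succ_le fun k => hF1 k x
  refine ⟨hanti, tendsto_order.2 ⟨fun a ha => ?_, fun b hb => ?_⟩⟩
  · exact Eventually.of_forall fun k => ha.trans ((F k).2.2 x)
  · obtain ⟨c, hc1, hc2⟩ := EReal.lt_iff_exists_real_btwn.1 hb
    obtain ⟨φ, hφ, huφ, hφc⟩ := exists_continuous_gt_of_usc hu.1 hc1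
    obtain ⟨v, hv, hvφ, huv⟩ := exists_mem_SHo_between hm hmn hu hφ huφ
    have hmem : (x, c) ∈ ⋃ i, s i :=
      Set.mem_iUnion.2 ⟨⟨v, hv, huv⟩, (hvφ x).trans_lt hφc⟩
    rw [← hT] at hmem
    obtain ⟨i, hiT, hi⟩ := Set.mem_iUnion₂.1 hmem
    obtain ⟨k, rfl⟩ : i ∈ Set.range g := hg ▸ Set.mem_insert_of_mem _ hiT
    filter_upwards [eventually_ge_atTop k] with j hj
    refine lt_trans (EReal.coe_lt_coe_iff.2 ?_) hc2
    exact ((hanti hj).trans (hF2 k x)).trans_lt hi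

theorem mem_SH_of_decreasing [CompactSpace X] {u : X → EReal} {f : ℕ → X → ℝ}
    (hf : ∀ j, f j ∈ SHo m X) (hfu : DecreasesTo f u) : u ∈ SH m X := by
  have hle : ∀ j x, u x ≤ f j x := fun j x => le_of_tendsto (hfu x).2 (by
    filter_upwards [eventually_ge_atTop j] with k hk
    exact EReal.coe_le_coe_iff.2 ((hfu x).1 hk))
  refine ⟨⟨fun x b hb => ?_, fun x => ((hle 0 x).trans_lt (EReal.coe_lt_top _)).ne⟩,
    fun z μ hμ => ?_⟩
  · obtain ⟨j, hj⟩ := ((hfu x).2.eventually_lt_const hb).exists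
    have hc : Continuous fun y => (f j y : EReal) :=
      continuous_coe_real_ereal.comp (continuous_of_mem_SHo (hf j))
    filter_upwards [hc.continuousAt.eventually_lt_const hj] with y hy
    exact (hle j y).trans_lt hy
  · have := hμ.1
    exact le_extIntegral_of_antitone (fun j => (continuous_of_mem_SHo
      (hf j)).integrable_of_hasCompactSupport (HasCompactSupport.of_compactSpace _)) hfu
      fun j => (hle j z).trans (EReal.coe_le_coe_iff.2 (hμ.2.2 _ (hf j)))

/-- Choose `v j` in `SHo` with `g < v j ≤ g + (d j - d (j + 1))`. Then `v j - d j ≤ g - d (j + 1) <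
v (j + 1) - d (j + 1)`, so the shifted functions increase to `g`. -/
theorem exists_increasing_of_mem_SH [CompactSpace X] (hm : 1 ≤ m) (hmn : m ≤ n) {u : X → EReal}
    (hu : u ∈ SH m X ∩ CX X) : ∃ f : ℕ → X → ℝ, (∀ j, f j ∈ SHo m X) ∧ IncreasesTo f u := by
  obtain ⟨hu, g, hg, hug⟩ := hu
  set d : ℕ → ℝ := fun j => 1 / ((j : ℝ) + 1) with hd
  have hd1 : ∀ j, d (j + 1) < d j := fun j => by
    simp only [hd]
    push_cast
    exact one_div_lt_one_div_of_lt (by positivity) (by linarith)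
  have hex : ∀ j, ∃ v ∈ SHo m X, (∀ x, v x ≤ g x + (d j - d (j + 1))) ∧ ∀ x, g x < v x := by
    intro j
    obtain ⟨v, hv, h1, h2⟩ := exists_mem_SHo_between hm hmn hu
      (φ := fun x => g x + (d j - d (j + 1))) (hg.add continuous_const) fun x => by
        rw [hug]
        exact EReal.coe_lt_coe_iff.2 (by linarith [hd1 j])
    exact ⟨v, hv, h1, fun x => by have := h2 x; rw [hug] at this; exact EReal.coe_lt_coe_iff.1 this⟩
  choose v hv hv1 hv2 using hex
  refine ⟨fun j x => v j x + -d j, fun j => add_mem_SHo hm hmn (hv j) (const_mem_SHo hm hmn _),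
    fun x => ⟨monotone_nat_of_le_succ fun j => ?_, ?_⟩⟩
  · linarith [hv1 j x, hv2 (j + 1) x]
  · rw [hug]
    refine continuous_coe_real_ereal.continuousAt.tendsto.comp ?_
    have hd0 : Tendsto d atTop (𝓝 0) := tendsto_one_div_add_atTop_nhds_zero_nat
    have h1 : Tendsto (fun j => g x - d j) atTop (𝓝 (g x)) := by
      simpa using tendsto_const_nhds.sub hd0
    refine tendsto_of_tendsto_of_tendsto_of_le_of_le h1 tendsto_const_nhds (fun j => ?_)
      fun j => ?_
    · linarith [hv2 j x]
    · have h2 : 0 < d (j + 1) := by simp only [hd]; positivity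
      linarith [hv1 j x]

/-- An increasing limit of continuous functions is lower semicontinuous, so with `hu` it is
continuous; the Jensen inequalities pass to the limit because `∫ f j ≤ ∫ u`. -/
theorem mem_SH_inter_CX_of_increasing [CompactSpace X] {u : X → EReal} (hu : u ∈ USC X)
    {f : ℕ → X → ℝ} (hf : ∀ j, f j ∈ SHo m X) (hfu : IncreasesTo f u) : u ∈ SH m X ∩ CX X := by
  have hle : ∀ j x, (f j x : EReal) ≤ u x := fun j x => ge_of_tendsto (hfu x).2 (by
    filter_upwards [eventually_ge_atTop j] with k hk
    exact EReal.coe_le_coe_iff.2 ((hfu x).1 hk))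
  have hbot : ∀ x, u x ≠ ⊥ := fun x h => EReal.coe_ne_bot _ (le_bot_iff.1 ((hle 0 x).trans h.le))
  have hlsc : LowerSemicontinuous u := fun x b hb => by
    obtain ⟨j, hj⟩ := ((hfu x).2.eventually_const_lt hb).exists
    have hc : Continuous fun y => (f j y : EReal) :=
      continuous_coe_real_ereal.comp (continuous_of_mem_SHo (hf j))
    filter_upwards [hc.continuousAt.eventually_const_lt hj] with y hy
    exact hy.trans_le (hle j y)
  have hcont : Continuous u := continuous_iff_lower_upperSemicontinuous.2 ⟨hlsc, hu.1⟩
  have hg : Continuous fun x => (u x).toReal := EReal.continuousOn_toReal.comp_continuous hcont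
    fun x => by simp [hbot x, hu.2 x]
  have hug : ∀ x, u x = ((u x).toReal : EReal) := fun x => (EReal.coe_toReal (hu.2 x) (hbot x)).symm
  refine ⟨⟨hu, fun z μ hμ => ?_⟩, _, hg, hug⟩
  have e : extIntegral u μ = extIntegral (fun x => ((u x).toReal : EReal)) μ := by
    congr 1
    exact funext hug
  rw [e, extIntegral_coe_of_continuous hμ hg]
  refine le_of_tendsto' (hfu z).2 fun j => EReal.coe_le_coe_iff.2 ?_
  have := hμ.1
  refine (hμ.2.2 _ (hf j)).trans (integral_mono
    ((continuous_of_mem_SHo (hf j)).integrable_of_hasCompactSupport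
      (HasCompactSupport.of_compactSpace _))
    (hg.integrable_of_hasCompactSupport (HasCompactSupport.of_compactSpace _)) fun x => ?_)
  have := hle j x
  rw [hug] at this
  exact EReal.coe_le_coe_iff.1 this

end MSubh

end

theorem theorem2p5 (n m : ℕ) (hm : 1 ≤ m) (hmn : m ≤ n)
    (X : Set (MSubh.Cn n)) (hX : IsCompact X) :
    (∀ u ∈ MSubh.USC X,
      u ∈ MSubh.SH m X ∩ MSubh.CX X ↔
        ∃ f : ℕ → X → ℝ, (∀ j, f j ∈ MSubh.SHo m X) ∧ MSubh.IncreasesTo f u) ∧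
    (∀ u : X → EReal,
      u ∈ MSubh.SH m X ↔
        ∃ f : ℕ → X → ℝ, (∀ j, f j ∈ MSubh.SHo m X) ∧ MSubh.DecreasesTo f u) := by
  have : CompactSpace X := isCompact_iff_compactSpace.1 hX
  refine ⟨fun u hu => ⟨fun h => MSubh.exists_increasing_of_mem_SH hm hmn h, ?_⟩,
    fun u => ⟨fun h => MSubh.exists_decreasing_of_mem_SH hm hmn h, ?_⟩⟩
  · rintro ⟨f, hf, hfu⟩
    exact MSubh.mem_SH_inter_CX_of_increasing hu hf hfu
  · rintro ⟨f, hf, hfu⟩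
    exact MSubh.mem_SH_of_decreasing hf hfu
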